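/- Let $n\ge 1$ and $d\ge 0$ be integers. For a partition $\lambda$ of $d$ let $H_\lambda=\mathbb{C}[S_d]c_\lambda$ be the irreducible representation of the symmetric group $S_d$ generated by a Young symmetrizer $c_\lambda$ of shape $\lambda$ (so that $H_{(d)}$ is trivial), and let $\chi_\lambda$ be its character. Let $c^{\gamma}_{\alpha,\beta}$ be the Littlewood–Richardson coefficients, $s_\alpha s_\beta=\sum_\gamma c^\gamma_{\alpha,\beta}s_\gamma$ for Schur functions, and let $$c^{\lambda}_{\beta_1,\dots,\beta_n}=\sum_{\alpha_1,\dots,\alpha_{n-2}}c^{\lambda}_{\alpha_1,\beta_1}c^{\alpha_1}_{\alpha_2,\beta_2}\cdots c^{\alpha_{n-3}}_{\alpha_{n-2},\beta_{n-2}}c^{\alpha_{n-2}}_{\beta_{n-1},\beta_n}$$ be the generalized ones (for $n=2$ this is $c^\lambda_{\beta_1,\beta_2}$, and for $n=1$ it is $c^\lambda_{\beta}=\delta_{\lambda\beta}$). Let $A^n_d=(a^n_{\lambda,\mu})$ be the matrix, indexed by the partitions $\lambda,\mu$ of $d$, with entries $$a^n_{\lambda,\mu}=\sum_{\beta_1,\dots,\beta_n}c^{\lambda}_{\beta_1,\dots,\beta_n}\,c^{\mu}_{\beta_1,\dots,\beta_n},$$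 the sum being over all $n$-tuples of partitions. For each partition $\mu$ of $d$ choose $\sigma_\mu\in S_d$ whose disjoint cycles (fixed points included) have lengths the parts of $\mu$, and for $\sigma\in S_d$ let $p(\sigma)$ be the number of its disjoint cycles (fixed points included). Let $\mathsf X=(\chi_\lambda(\sigma_\mu))_{\lambda,\mu}$ be the character table of $S_d$. Then $\mathsf X$ is invertible and $$A^n_d=\mathsf X D\mathsf X^{-1},$$ where $D$ is the diagonal matrix whose entry at $\mu$ is $n^{p(\sigma_\mu)}$. Consequently $A^n_d$ is diagonalizable over $\mathbb{C}$, and its set of eigenvalues is $\{n^{p(\sigma)}:\sigma\in S_d\}$. -/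

import Mathlib

noncomputable section

namespace TypeI

/-! ### The irreducible representations `H_λ` of the symmetric group -/

/-- The rows `λ₁ ≥ λ₂ ≥ ⋯ ≥ λ_p > 0` of a partition `λ` of `d`, as a composition of `d`.
Its blocks cut `0, 1, …, d - 1` into consecutive runs of lengths `λ₁, λ₂, …`; this is the Young
tableau of shape `λ` that is filled row by row with `0, 1, …, d - 1`. -/
def rows {d : ℕ} (lam : d.Partition) : Composition d where
  blocks := lam.parts.sort (· ≥ ·)
  blocks_pos := fun h => lam.parts_pos ((Multiset.mem_sort _).1 h)
  blocks_sum := by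
    rw [← Multiset.sum_coe, Multiset.sort_eq, lam.parts_sum]

/-- The row of the tableau that contains the entry `i`. -/
def rowOf {d : ℕ} (lam : d.Partition) (i : Fin d) : ℕ := ((rows lam).index i : ℕ)

/-- The column of the tableau that contains the entry `i`. -/
def colOf {d : ℕ} (lam : d.Partition) (i : Fin d) : ℕ := ((rows lam).invEmbedding i : ℕ)

open scoped Classical in
/-- The Young symmetrizer `c_λ = (∑_{p ∈ P} p) (∑_{q ∈ Q} sgn(q) q)` in `ℂ[S_d]`, where `P` and `Q`
are the groups of permutations that preserve every row, respectively every column, of the tableau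
of shape `λ`. -/
def youngSymmetrizer {d : ℕ} (lam : d.Partition) : MonoidAlgebra ℂ (Equiv.Perm (Fin d)) :=
  (∑ p : Equiv.Perm (Fin d) with ∀ i, rowOf lam (p i) = rowOf lam i,
      MonoidAlgebra.of ℂ (Equiv.Perm (Fin d)) p) *
    ∑ q : Equiv.Perm (Fin d) with ∀ i, colOf lam (q i) = colOf lam i,
      ((Equiv.Perm.sign q : ℤ) : ℂ) • MonoidAlgebra.of ℂ (Equiv.Perm (Fin d)) q

/-- The module `H_λ = ℂ[S_d] c_λ`, a left ideal of the group algebra. -/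
abbrev H {d : ℕ} (lam : d.Partition) :
    Submodule (MonoidAlgebra ℂ (Equiv.Perm (Fin d))) (MonoidAlgebra ℂ (Equiv.Perm (Fin d))) :=
  Submodule.span (MonoidAlgebra ℂ (Equiv.Perm (Fin d))) {youngSymmetrizer lam}

/-- The representation of `S_d` on `H_λ` by left multiplication. -/
def rep {d : ℕ} (lam : d.Partition) : Representation ℂ (Equiv.Perm (Fin d)) (H lam) :=
  Representation.ofModule' (H lam)

/-- The character `χ_λ` of `H_λ`. -/
def chi {d : ℕ} (lam : d.Partition) (s : Equiv.Perm (Fin d)) : ℂ := (rep lam).character s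

/-- `p(σ)`: the number of disjoint cycles of `σ`, fixed points being cycles of length one. -/
def numCycles {d : ℕ} (s : Equiv.Perm (Fin d)) : ℕ := Multiset.card s.partition.parts

/-- `σ` lies in the conjugacy class attached to the partition `μ`: the lengths of its disjoint
cycles (fixed points being cycles of length one) are the parts of `μ`. -/
def HasType {d : ℕ} (s : Equiv.Perm (Fin d)) (mu : d.Partition) : Prop :=
  s.partition.parts = mu.parts

/-- The character table with entry `χ_λ(σ_μ)` in row `λ` and column `μ`, where `σ_μ` is the chosen
representative of the class attached to `μ`. -/
def charTable {d : ℕ} (s : d.Partition → Equiv.Perm (Fin d)) :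
    Matrix d.Partition d.Partition ℂ :=
  Matrix.of fun lam mu => chi lam (s mu)

/-! ### Schur functions and Littlewood-Richardson coefficients -/

/-- The `j`-th part `λ_j` (counted from `j = 0`), which is `0` beyond the length of `λ`. -/
def part {d : ℕ} (lam : d.Partition) (j : ℕ) : ℕ := (rows lam).blocks.getD j 0

/-- The alternant `det (x_i ^ (a_j + N - 1 - j))`, `0 ≤ i, j < N`. -/
def alternant (N : ℕ) (a : ℕ → ℕ) : MvPolynomial (Fin N) ℤ :=
  (Matrix.of fun i j : Fin N =>
    (MvPolynomial.X i : MvPolynomial (Fin N) ℤ) ^ (a j + (N - 1 - j))).det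

/-- The Schur polynomial `s_λ(x_1, …, x_N)`, for `λ` with at most `N` parts, as the quotient of the
alternant of `λ` by the Vandermonde determinant. -/
def schur (N : ℕ) {d : ℕ} (lam : d.Partition) : FractionRing (MvPolynomial (Fin N) ℤ) :=
  algebraMap _ _ (alternant N (part lam)) / algebraMap _ _ (alternant N fun _ => 0)

/-- The type of all partitions of all natural numbers: `⟨m, β⟩` is a partition `β` of `m = |β|`. -/
abbrev Ptn : Type := Σ m : ℕ, m.Partition

/-- The finitely many partitions `β` with `|β| ≤ m`. -/
def ptnsLE (m : ℕ) : Finset Ptn :=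
  (Finset.range (m + 1)).sigma fun _ => Finset.univ

/-- `c` is the family of coefficients of the product `s_α s_β` in the basis of Schur functions. As
`s_α s_β` is homogeneous of degree `N = |α| + |β|`, only partitions `γ` of `N` occur, and since such
a `γ` has at most `N` parts, the expansion can be read in `N` variables. -/
def IsSchurExpansion (al be : Ptn) (c : Ptn → ℤ) : Prop :=
  (∀ ga : Ptn, ga.1 ≠ al.1 + be.1 → c ga = 0) ∧
    schur (al.1 + be.1) al.2 * schur (al.1 + be.1) be.2 =
      ∑ ga : (al.1 + be.1).Partition, c ⟨al.1 + be.1, ga⟩ • schur (al.1 + be.1) ga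

/-- The Littlewood-Richardson coefficient `c^γ_{α,β}`: the coefficient of `s_γ` in `s_α s_β`. -/
def lr (ga al be : Ptn) : ℤ := Classical.epsilon (IsSchurExpansion al be) ga

open scoped Classical in
/-- The generalized Littlewood-Richardson coefficient
`c^γ_{β_1,…,β_n} = ∑ c^γ_{α_1,β_1} c^{α_1}_{α_2,β_2} ⋯ c^{α_{n-2}}_{β_{n-1},β_n}`; for `n = 1` it is
`1` if `γ = β_1` and `0` otherwise, and for `n = 0` it is `1` if `γ` is empty and `0` otherwise.
The sum over all `α_1` is finite as `c^γ_{α_1,β_1} = 0` unless `|α_1| ≤ |γ|`. -/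
def genLR : Ptn → List Ptn → ℤ
  | ga, [] => if ga.1 = 0 then 1 else 0
  | ga, [be] => if ga = be then 1 else 0
  | ga, [be₁, be₂] => lr ga be₁ be₂
  | ga, be₁ :: be₂ :: be₃ :: l => ∑ al ∈ ptnsLE ga.1, lr ga al be₁ * genLR al (be₂ :: be₃ :: l)

/-! ### The matrix `A^n_d` -/

/-- The matrix `A^n_d` with entries
`a^n_{λ,μ} = ∑_{β_1,…,β_n} c^λ_{β_1,…,β_n} c^μ_{β_1,…,β_n}`. The sum is over all `n`-tuples of
partitions; those with some `|β_i| > d` contribute zero and are left out. -/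
def A (n d : ℕ) : Matrix d.Partition d.Partition ℤ :=
  Matrix.of fun lam mu =>
    ∑ be ∈ Fintype.piFinset fun _ : Fin n => ptnsLE d,
      genLR ⟨d, lam⟩ (List.ofFn be) * genLR ⟨d, mu⟩ (List.ofFn be)

end TypeI

end

namespace TypeI

open Finset

/-! ### Parts of a partition and the cells of its tableau -/

section Parts

variable {d : ℕ}

/-! Iterating the Littlewood–Richardson rule shows that $c^\lambda_{\beta_1,\dots,\beta_n}$ is the
coefficient of $s_\lambda$ in $\prod_i s_{\beta_i}$ (`genLR_eq_schurCoeff`). Hence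
$a^n_{\lambda,\mu}$ is the coefficient of $s_\lambda(x)s_\mu(y)$ in the degree $d$ part of
$(\sum_\beta s_\beta(x)s_\beta(y))^n$. By the Cauchy identity (`sum_schurPoly_mul_schurPoly`) this
part is $h_d$ of the alphabet consisting of $n$ copies of all products $x_iy_j$.

The cycle index formula `sum_fixSum` gives $d!\,h_d=\sum_g p_g$, where $p_g$ is the product of power
sums attached to the cycles of $g$. On that alphabet $p_g$ equals $n^{p(g)}p_g(x)p_g(y)$. With
$\omega_\lambda(g)$ the coefficient of $s_\lambda$ in $p_g$, this yields
$d!\,a^n_{\lambda,\mu}=\sum_g n^{p(g)}\omega_\lambda(g)\omega_\mu(g)$ (`card_mul_A`).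

It remains to see that $\omega_\lambda=\chi_\lambda$, the Frobenius formula
`omegaTable_eq_charTable`. Both families are orthonormal: the $\omega_\lambda$ by the Cauchy
identity (`sum_omega_mul_omega`), the $\chi_\lambda$ by the multiplication rules of Young
symmetrizers (`sum_chi_mul_chi`). The matrix of scalar products
$\langle\omega_\lambda,\chi_\mu\rangle$ is therefore orthogonal. It is also unitriangular for the
dominance order: expand $p_g$ over the colourings fixed by $g$. A colouring contributes to
$\omega_\lambda$ only if its content dominates $\lambda$, and its stabilizer has nonzero average of
$\chi_\mu$ only if its content is dominated by $\mu$. A unitriangular orthogonal matrix is the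
identity.

Finally, with $W$ the diagonal matrix of class sizes divided by $d!$, orthonormality reads $\mathsf
X W\mathsf X^T=1$, so $W\mathsf X^T=\mathsf X^{-1}$, and the formula for $a^n_{\lambda,\mu}$ is
$\mathsf XDW\mathsf X^T=\mathsf XD\mathsf X^{-1}$. -/

theorem part_eq_getElem (lam : d.Partition) {j : ℕ} (hj : j < (rows lam).length) :
    part lam j = (rows lam).blocks[j] := by
  simp only [part]
  exact List.getD_eq_getElem _ _ hj

theorem part_of_length_le (lam : d.Partition) {j : ℕ} (hj : (rows lam).length ≤ j) :
    part lam j = 0 :=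
  List.getD_eq_default _ _ hj

theorem part_of_le (lam : d.Partition) {j : ℕ} (hj : d ≤ j) : part lam j = 0 :=
  part_of_length_le lam ((rows lam).length_le.trans hj)

theorem part_antitone (lam : d.Partition) : Antitone (part lam) := by
  intro i j hij
  rcases lt_or_ge j (rows lam).length with hj | hj
  · rw [part_eq_getElem lam hj, part_eq_getElem lam (hij.trans_lt hj)]
    have h : (rows lam).blocks.Pairwise (· ≥ ·) := Multiset.pairwise_sort _ _
    rcases hij.eq_or_lt with rfl | hlt
    · exact le_rfl
    · exact List.pairwise_iff_getElem.1 h i j _ _ hlt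
  · simp [part_of_length_le lam hj]

theorem part_injective : Function.Injective (part : d.Partition → ℕ → ℕ) := by
  intro lam mu h
  have hl : ∀ nu : d.Partition, ∀ j, j < (rows nu).length ↔ 0 < part nu j := by
    intro nu j
    constructor
    · intro hj
      rw [part_eq_getElem nu hj]
      exact (rows nu).blocks_pos' j hj
    · intro hj
      by_contra hc
      rw [part_of_length_le nu (not_lt.1 hc)] at hj
      exact lt_irrefl _ hj
  have hlen : (rows lam).length = (rows mu).length := by
    have key : ∀ j, j < (rows lam).length ↔ j < (rows mu).length := by
      intro j; rw [hl, hl, h]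
    exact le_antisymm (not_lt.1 fun h' => lt_irrefl _ ((key _).1 h'))
      (not_lt.1 fun h' => lt_irrefl _ ((key _).2 h'))
  have hb : (rows lam).blocks = (rows mu).blocks := by
    apply List.ext_getElem hlen
    intro i h1 h2
    rw [← part_eq_getElem lam h1, ← part_eq_getElem mu h2, h]
  ext1
  have h1 : (lam.parts.sort (· ≥ ·) : Multiset ℕ) = (mu.parts.sort (· ≥ ·) : Multiset ℕ) :=
    congrArg _ hb
  rwa [Multiset.sort_eq, Multiset.sort_eq] at h1

theorem exists_part_eq (f : ℕ → ℕ) (hf : Antitone f) (N : ℕ) (hN : f N = 0)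
    (hs : ∑ j ∈ range N, f j = d) : ∃ lam : d.Partition, part lam = f := by
  classical
  have hex : ∃ j, f j = 0 := ⟨N, hN⟩
  -- Parts of a partition are positive, so the list is cut at the first zero of `f`; by monotonicity
  -- nothing is lost.
  set k := Nat.find hex with hk
  have hk0 : ∀ j, k ≤ j → f j = 0 := fun j hj =>
    Nat.le_zero.1 ((hf hj).trans (Nat.find_spec hex).le)
  have hkN : k ≤ N := Nat.find_min' hex hN
  have hsum : ∑ j ∈ range k, f j = d := by
    rw [← hs]
    refine sum_subset (range_mono hkN) fun j _ hj => hk0 j ?_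
    simpa using hj
  let lam : d.Partition :=
    { parts := ((List.range k).map f : List ℕ)
      parts_pos := by
        intro i hi
        simp only [Multiset.mem_coe, List.mem_map, List.mem_range] at hi
        obtain ⟨j, hj, rfl⟩ := hi
        exact Nat.pos_of_ne_zero (Nat.find_min hex hj)
      parts_sum := by
        rw [Multiset.sum_coe, ← hsum]
        rfl }
  have hb : (rows lam).blocks = (List.range k).map f := by
    change Multiset.sort (((List.range k).map f : List ℕ) : Multiset ℕ) (· ≥ ·) = _
    rw [Multiset.coe_sort]
    apply List.mergeSort_eq_self
    rw [List.pairwise_map]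
    refine List.pairwise_lt_range.imp ?_
    intro a b hab
    simpa using hf hab.le
  refine ⟨lam, funext fun j => ?_⟩
  rw [part, hb]
  rcases lt_or_ge j k with hj | hj
  · rw [List.getD_eq_getElem _ _ (by simpa using hj)]
    simp
  · rw [List.getD_eq_default _ _ (by simpa using hj), hk0 j hj]

theorem rowOf_lt_length (lam : d.Partition) (i : Fin d) : rowOf lam i < (rows lam).length :=
  ((rows lam).index i).2

theorem rowOf_lt (lam : d.Partition) (i : Fin d) : rowOf lam i < d :=
  (rowOf_lt_length lam i).trans_le (rows lam).length_le

theorem colOf_lt_part (lam : d.Partition) (i : Fin d) : colOf lam i < part lam (rowOf lam i) := by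
  rw [part_eq_getElem lam (rowOf_lt_length lam i)]
  exact ((rows lam).invEmbedding i).2

theorem cell_injective (lam : d.Partition) {i j : Fin d} (hr : rowOf lam i = rowOf lam j)
    (hc : colOf lam i = colOf lam j) : i = j := by
  have hr' : (rows lam).index i = (rows lam).index j := Fin.ext hr
  rw [colOf, colOf, Composition.coe_invEmbedding, Composition.coe_invEmbedding, hr'] at hc
  have h1 := (rows lam).sizeUpTo_index_le i
  have h2 := (rows lam).sizeUpTo_index_le j
  rw [hr'] at h1
  ext
  omega

theorem exists_cell (lam : d.Partition) {r c : ℕ} (h : c < part lam r) :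
    ∃ i, rowOf lam i = r ∧ colOf lam i = c := by
  have hr : r < (rows lam).length := by
    by_contra hc
    rw [part_of_length_le lam (not_lt.1 hc)] at h
    exact absurd h (Nat.not_lt_zero _)
  rw [part_eq_getElem lam hr] at h
  refine ⟨(rows lam).embedding ⟨r, hr⟩ ⟨c, h⟩, ?_, ?_⟩
  · rw [rowOf, Composition.index_embedding]
  · rw [colOf, Composition.invEmbedding_comp]

theorem card_rowOf_eq (lam : d.Partition) (r : ℕ) :
    #{i | rowOf lam i = r} = part lam r := by
  rw [← card_range (part lam r)]
  refine card_bij (fun i _ => colOf lam i) ?_ ?_ ?_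
  · intro i hi
    simp only [mem_filter, mem_univ, true_and] at hi
    subst hi
    exact mem_range.2 (colOf_lt_part lam i)
  · intro i hi j hj h
    simp only [mem_filter, mem_univ, true_and] at hi hj
    exact cell_injective lam (hi.trans hj.symm) h
  · intro c hc
    obtain ⟨i, hi, hi'⟩ := exists_cell lam (mem_range.1 hc)
    exact ⟨i, by simpa using hi, hi'⟩

theorem card_lt_eq_sum (f : Fin d → ℕ) (k : ℕ) :
    #{i | f i < k} = ∑ r ∈ range k, #{i | f i = r} := by
  rw [card_eq_sum_card_fiberwise (f := f) (t := range k) (by intro i hi; simpa using hi)]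
  refine sum_congr rfl fun r hr => ?_
  congr 1
  ext i
  simp only [mem_filter, mem_univ, true_and, and_iff_right_iff_imp]
  rintro rfl
  exact mem_range.1 hr

theorem card_rowOf_lt (lam : d.Partition) (k : ℕ) :
    #{i | rowOf lam i < k} = ∑ r ∈ range k, part lam r := by
  rw [card_lt_eq_sum]
  simp_rw [card_rowOf_eq]

theorem sum_part (lam : d.Partition) {N : ℕ} (hN : d ≤ N) : ∑ r ∈ range N, part lam r = d := by
  rw [← card_rowOf_lt, filter_true_of_mem fun i _ => (rowOf_lt lam i).trans_le hN]
  simp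

/-- Dominance order of partitions, as domination of the partial sums of the parts. -/
def Dominated (lam mu : d.Partition) : Prop :=
  ∀ k, ∑ r ∈ range k, part lam r ≤ ∑ r ∈ range k, part mu r

theorem Dominated.antisymm {lam mu : d.Partition} (h : Dominated lam mu) (h' : Dominated mu lam) :
    lam = mu := by
  apply part_injective
  funext k
  have h1 := le_antisymm (h k) (h' k)
  have h2 := le_antisymm (h (k + 1)) (h' (k + 1))
  rw [sum_range_succ, sum_range_succ] at h2
  omega

/-- Two families with the same fibre cardinalities differ by a permutation of the indices. -/
theorem exists_perm_comp_eq {α ι : Type*} [Fintype α] [DecidableEq ι] (u v : α → ι)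
    (h : ∀ x, #{i | u i = x} = #{i | v i = x}) : ∃ s : Equiv.Perm α, ∀ i, u (s i) = v i := by
  classical
  have hx : ∀ x, Nonempty ({i // v i = x} ≃ {i // u i = x}) := fun x => by
    refine ⟨Fintype.equivOfCardEq ?_⟩
    rw [Fintype.card_subtype, Fintype.card_subtype, h]
  let e := fun x => (hx x).some
  refine ⟨(Equiv.sigmaFiberEquiv v).symm.trans
    ((Equiv.sigmaCongrRight e).trans (Equiv.sigmaFiberEquiv u)), fun i => ?_⟩
  exact (e (v i) ⟨i, rfl⟩).2

/-- If row `k` reaches column `c`, the first `k` rows all meet this column, while `f` takes each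
value below `k` at most once on it. Otherwise the whole column already lies in the first `k` rows.
-/
theorem card_col_le (lam : d.Partition) (f : Fin d → ℕ)
    (hf : ∀ i j, f i = f j → colOf lam i = colOf lam j → i = j) (k c : ℕ) :
    #{i | f i < k ∧ colOf lam i = c} ≤ #{i | rowOf lam i < k ∧ colOf lam i = c} := by
  rcases lt_or_ge c (part lam k) with hc | hc
  · have h1 : #{i | f i < k ∧ colOf lam i = c} ≤ k := by
      conv_rhs => rw [← card_range k]
      refine card_le_card_of_injOn f ?_ ?_
      · intro i hi
        simp only [coe_filter, mem_univ, true_and, Set.mem_ofPred_eq] at hi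
        simpa using hi.1
      · intro i hi j hj hij
        simp only [coe_filter, mem_univ, true_and, Set.mem_ofPred_eq] at hi hj
        exact hf i j hij (hi.2.trans hj.2.symm)
    refine h1.trans ?_
    conv_lhs => rw [← card_range k]
    refine card_le_card_of_surjOn (rowOf lam) ?_
    intro r hr
    have hr' : r < k := by simpa using hr
    obtain ⟨i, hi, hi'⟩ := exists_cell lam (hc.trans_le (part_antitone lam hr'.le))
    refine ⟨i, ?_, hi⟩
    simp only [coe_filter, mem_univ, true_and, Set.mem_ofPred_eq]
    exact ⟨hi ▸ hr', hi'⟩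
  · refine card_le_card fun i hi => ?_
    simp only [mem_filter, mem_univ, true_and] at hi ⊢
    refine ⟨?_, hi.2⟩
    by_contra hk
    have := (colOf_lt_part lam i).trans_le (part_antitone lam (not_lt.1 hk))
    omega

theorem card_lt_eq_sum_col (lam : d.Partition) (f : Fin d → ℕ) (k : ℕ) :
    #{i | f i < k} = ∑ c ∈ univ.image (colOf lam), #{i | f i < k ∧ colOf lam i = c} := by
  rw [card_eq_sum_card_fiberwise (f := colOf lam) (t := univ.image (colOf lam))
    (by intro i _; simp)]
  simp_rw [filter_filter]

/-- If no two entries share both their `f`-value and their column, then the partial sums of the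
content of `f` are dominated by those of the shape. -/
theorem card_lt_le_of_injective (lam : d.Partition) (f : Fin d → ℕ)
    (hf : ∀ i j, f i = f j → colOf lam i = colOf lam j → i = j) (k : ℕ) :
    #{i | f i < k} ≤ ∑ r ∈ range k, part lam r := by
  rw [← card_rowOf_lt, card_lt_eq_sum_col lam f, card_lt_eq_sum_col lam (rowOf lam)]
  exact sum_le_sum fun c _ => card_col_le lam f hf k c

/-- If moreover the content of `f` is the shape, then a permutation preserving the columns moves
`f` to the row function. -/
theorem exists_col_perm (lam : d.Partition) (f : Fin d → ℕ)
    (hf : ∀ i j, f i = f j → colOf lam i = colOf lam j → i = j)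
    (hc : ∀ r, #{i | f i = r} = part lam r) :
    ∃ q : Equiv.Perm (Fin d), (∀ i, colOf lam (q i) = colOf lam i) ∧
      ∀ i, f (q i) = rowOf lam i := by
  have hlt : ∀ k c, #{i | f i < k ∧ colOf lam i = c} =
      #{i | rowOf lam i < k ∧ colOf lam i = c} := by
    intro k c
    by_cases hcm : c ∈ univ.image (colOf lam)
    -- The column-wise inequalities of `card_col_le` add up to an equality, so each of them is an
    -- equality.
    · have htot : ∑ c ∈ univ.image (colOf lam), #{i | f i < k ∧ colOf lam i = c} =
          ∑ c ∈ univ.image (colOf lam), #{i | rowOf lam i < k ∧ colOf lam i = c} := by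
        rw [← card_lt_eq_sum_col, ← card_lt_eq_sum_col, card_lt_eq_sum, card_rowOf_lt]
        exact sum_congr rfl fun r _ => hc r
      exact (sum_eq_sum_iff_of_le fun c _ => card_col_le lam f hf k c).1 htot c hcm
    · have h0 : ∀ i, colOf lam i ≠ c := fun i hi => hcm (mem_image.2 ⟨i, mem_univ _, hi⟩)
      simp [h0]
  have hsplit : ∀ (u : Fin d → ℕ) (r c : ℕ), #{i | u i < r + 1 ∧ colOf lam i = c} =
      #{i | u i < r ∧ colOf lam i = c} + #{i | (u i, colOf lam i) = (r, c)} := by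
    intro u r c
    rw [← card_union_of_disjoint]
    · congr 1
      ext i
      simp only [mem_filter, mem_univ, true_and, mem_union, Prod.mk.injEq]
      omega
    · rw [disjoint_left]
      intro i
      simp only [mem_filter, mem_univ, true_and, Prod.mk.injEq]
      omega
  -- Differences in `k` turn the equalities into equal fibres for the pairs (value, column) and
  -- (row, column).
  obtain ⟨q, hq⟩ := exists_perm_comp_eq (fun i => (f i, colOf lam i))
    (fun i => (rowOf lam i, colOf lam i)) (by
      rintro ⟨r, c⟩
      have h1 := hsplit f r c
      have h2 := hsplit (rowOf lam) r c
      rw [hlt, hlt] at h1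
      omega)
  exact ⟨q, fun i => (Prod.mk.inj (hq i)).2, fun i => (Prod.mk.inj (hq i)).1⟩

end Parts

end TypeI

noncomputable section

namespace TypeI

open Finset

/-! ### Young symmetrizers in the group algebra -/

section GroupAlgebra

variable {d : ℕ}

/-- The group algebra `ℂ[S_d]`. -/
abbrev GroupAlg (d : ℕ) : Type := MonoidAlgebra ℂ (Equiv.Perm (Fin d))

/-- A permutation as an element of the group algebra. -/
abbrev elt (g : Equiv.Perm (Fin d)) : GroupAlg d := MonoidAlgebra.of ℂ (Equiv.Perm (Fin d)) g

/-- The sum of the permutations that preserve a function. -/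
def stabSum (f : Fin d → ℕ) : GroupAlg d :=
  ∑ p : Equiv.Perm (Fin d) with ∀ i, f (p i) = f i, elt p

/-- The signed sum of the permutations that preserve the columns of the tableau. -/
def colSum (lam : d.Partition) : GroupAlg d :=
  ∑ q : Equiv.Perm (Fin d) with ∀ i, colOf lam (q i) = colOf lam i,
    ((Equiv.Perm.sign q : ℤ) : ℂ) • elt q

theorem youngSymmetrizer_eq (lam : d.Partition) :
    youngSymmetrizer lam = stabSum (rowOf lam) * colSum lam := by
  unfold youngSymmetrizer stabSum colSum
  congr!

theorem elt_mul (g h : Equiv.Perm (Fin d)) : elt (g * h) = elt g * elt h := map_mul _ _ _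

theorem coeff_elt_mul (g k : Equiv.Perm (Fin d)) (x : GroupAlg d) :
    (elt g * x).coeff k = x.coeff (g⁻¹ * k) := by
  simp [elt, MonoidAlgebra.of_apply]

theorem sum_coeff_smul_elt (x : GroupAlg d) : ∑ g, x.coeff g • elt g = x := by
  conv_rhs => rw [← MonoidAlgebra.sum_coeff_single x]
  rw [Finsupp.sum_fintype _ _ (by simp)]
  refine sum_congr rfl fun g _ => ?_
  simp [elt, MonoidAlgebra.of_apply]

/-- The stabilizer of `f ∘ h` is the conjugate by `h⁻¹` of the stabilizer of `f`. -/
theorem stabSum_mul_elt (f : Fin d → ℕ) (h : Equiv.Perm (Fin d)) :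
    stabSum f * elt h = elt h * stabSum (f ∘ h) := by
  rw [stabSum, stabSum, sum_mul, mul_sum]
  refine sum_nbij' (fun p => h⁻¹ * p * h) (fun p => h * p * h⁻¹) ?_ ?_ ?_ ?_ ?_
  · intro p hp
    simp only [mem_filter, mem_univ, true_and] at hp ⊢
    intro i
    simp [hp]
  · intro p hp
    simp only [mem_filter, mem_univ, true_and, Function.comp] at hp ⊢
    intro i
    simpa using hp (h⁻¹ i)
  · intro p _; group
  · intro p _; group
  · intro p _
    rw [← elt_mul, ← elt_mul]
    congr 1
    group

theorem stabSum_mul_elt_of_stab {f : Fin d → ℕ} {h : Equiv.Perm (Fin d)} (hh : ∀ i, f (h i) = f i) :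
    stabSum f * elt h = stabSum f := by
  rw [stabSum, sum_mul]
  refine sum_nbij' (fun p => p * h) (fun p => p * h⁻¹) ?_ ?_ ?_ ?_ ?_
  · intro p hp
    simp only [mem_filter, mem_univ, true_and] at hp ⊢
    intro i
    simp [hp, hh]
  · intro p hp
    simp only [mem_filter, mem_univ, true_and] at hp ⊢
    intro i
    rw [Equiv.Perm.mul_apply, hp, ← hh (h⁻¹ i)]
    simp
  · intro p _; group
  · intro p _; group
  · intro p _; rw [← elt_mul]

theorem elt_mul_colSum {lam : d.Partition} {t : Equiv.Perm (Fin d)}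
    (ht : ∀ i, colOf lam (t i) = colOf lam i) :
    elt t * colSum lam = ((Equiv.Perm.sign t : ℤ) : ℂ) • colSum lam := by
  rw [colSum, mul_sum, smul_sum]
  refine sum_nbij' (fun p => t * p) (fun p => t⁻¹ * p) ?_ ?_ ?_ ?_ ?_
  · intro p hp
    simp only [mem_filter, mem_univ, true_and] at hp ⊢
    intro i
    simp [hp, ht]
  · intro p hp
    simp only [mem_filter, mem_univ, true_and] at hp ⊢
    intro i
    rw [← hp i, ← ht ((t⁻¹ * p) i)]
    simp
  · intro p _; group
  · intro p _; group
  · intro p _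
    rw [mul_smul_comm, ← elt_mul, smul_smul, Equiv.Perm.sign_mul]
    congr 1
    rcases Int.units_eq_one_or (Equiv.Perm.sign t) with h | h <;> simp [h]

/-- The symmetrizer of `f` is orthogonal to the antisymmetrizer of the columns as soon as two
entries share both the `f`-value and the column. -/
theorem stabSum_mul_colSum_eq_zero {lam : d.Partition} {f : Fin d → ℕ} {i j : Fin d} (hij : i ≠ j)
    (hf : f i = f j) (hc : colOf lam i = colOf lam j) : stabSum f * colSum lam = 0 := by
  have h1 : ∀ u : Fin d → ℕ, u i = u j → ∀ k, u (Equiv.swap i j k) = u k := by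
    intro u hu k
    rcases eq_or_ne k i with rfl | hki
    · rw [Equiv.swap_apply_left, hu]
    rcases eq_or_ne k j with rfl | hkj
    · rw [Equiv.swap_apply_right, hu]
    rw [Equiv.swap_apply_of_ne_of_ne hki hkj]
  -- The transposition of `i` and `j` preserves both `f` and the columns. Inserted between the two
  -- factors, it is absorbed on the left and produces a sign on the right.
  have h2 := stabSum_mul_elt_of_stab (h1 f hf)
  have h3 := elt_mul_colSum (lam := lam) (h1 _ hc)
  rw [Equiv.Perm.sign_swap hij] at h3
  have h4 : stabSum f * colSum lam = -(stabSum f * colSum lam) := by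
    conv_lhs => rw [← h2, mul_assoc, h3]
    simp
  have h5 : (2 : ℂ) • (stabSum f * colSum lam) = 0 := by
    rw [two_smul]
    nth_rewrite 2 [h4]
    exact add_neg_cancel _
  simpa using congrArg (fun y => (2⁻¹ : ℂ) • y) h5

theorem mul_mul_eq_zero_of_elt {a b : GroupAlg d} (h : ∀ g, a * elt g * b = 0) (x : GroupAlg d) :
    a * x * b = 0 := by
  rw [← sum_coeff_smul_elt x, mul_sum, sum_mul]
  refine sum_eq_zero fun g _ => ?_
  rw [mul_smul_comm, smul_mul_assoc, h, smul_zero]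

theorem card_comp_perm (f : Fin d → ℕ) (h : Equiv.Perm (Fin d)) (P : ℕ → Prop) [DecidablePred P] :
    #{i | P ((f ∘ h) i)} = #{i | P (f i)} :=
  card_bij (fun i _ => h i) (by simp) (by simp) fun b hb => ⟨h.symm b, by simpa using hb, by simp⟩

/-- By linearity `x` is a permutation `g`, and moving it to the left replaces `f` by `f ∘ g`, which
has the same content. Without domination, two entries must share both value and column. -/
theorem stabSum_mul_mul_colSum_eq_zero {lam : d.Partition} {f : Fin d → ℕ}
    (h : ¬ ∀ k, #{i | f i < k} ≤ ∑ r ∈ range k, part lam r) (x : GroupAlg d) :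
    stabSum f * x * colSum lam = 0 := by
  refine mul_mul_eq_zero_of_elt (fun g => ?_) x
  have hg : ¬ ∀ i j, (f ∘ g) i = (f ∘ g) j → colOf lam i = colOf lam j → i = j := by
    refine fun hinj => h fun k => ?_
    rw [← card_comp_perm f g (· < k)]
    exact card_lt_le_of_injective lam _ hinj k
  push Not at hg
  obtain ⟨i, j, h1, h2, h3⟩ := hg
  rw [stabSum_mul_elt, mul_assoc, stabSum_mul_colSum_eq_zero h3 h1 h2, mul_zero]

theorem youngSymmetrizer_mul_mul_eq_zero {lam mu : d.Partition} (h : ¬ Dominated lam mu)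
    (x : GroupAlg d) : youngSymmetrizer lam * x * youngSymmetrizer mu = 0 := by
  have h' : ¬ ∀ k, #{i | rowOf lam i < k} ≤ ∑ r ∈ range k, part mu r := by
    simp only [card_rowOf_lt]
    exact h
  have := stabSum_mul_mul_colSum_eq_zero h' (colSum lam * x * stabSum (rowOf mu))
  rw [youngSymmetrizer_eq, youngSymmetrizer_eq]
  simpa only [mul_assoc] using this

/-- An entry is determined by its row and column, so the row and column groups meet only in the
identity, which arises once in the product. -/
theorem youngSymmetrizer_coeff_one (lam : d.Partition) :
    (youngSymmetrizer lam).coeff 1 = 1 := by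
  have h0 : ∀ p : Equiv.Perm (Fin d), (∀ i, rowOf lam (p i) = rowOf lam i) →
      (∀ i, colOf lam (p i) = colOf lam i) → p = 1 := fun p h1 h2 =>
    Equiv.ext fun i => cell_injective lam (h1 i) (h2 i)
  have h1 : ∀ p : Equiv.Perm (Fin d), (∀ i, rowOf lam (p i) = rowOf lam i) →
      (elt p * colSum lam).coeff 1 = if p = 1 then 1 else 0 := by
    intro p hp
    rw [coeff_elt_mul, colSum, MonoidAlgebra.coeff_sum, Finsupp.finsetSum_apply]
    simp only [elt, MonoidAlgebra.of_apply, MonoidAlgebra.coeff_smul, MonoidAlgebra.coeff_single,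
      Finsupp.smul_apply, Finsupp.single_apply, mul_one]
    split_ifs with h
    · subst h
      rw [sum_eq_single_of_mem 1 (by simp)]
      · simp
      · intro q _ hq
        simp [hq]
    · refine sum_eq_zero fun q hq => ?_
      simp only [mem_filter, mem_univ, true_and] at hq
      rw [if_neg, smul_zero]
      rintro rfl
      refine h (inv_eq_one.1 (h0 _ (fun i => ?_) hq))
      rw [← hp (p⁻¹ i)]
      simp
  rw [youngSymmetrizer_eq, stabSum, sum_mul, MonoidAlgebra.coeff_sum, Finsupp.finsetSum_apply,
    sum_congr rfl fun p hp => h1 p (by simpa using hp), sum_ite_eq', if_pos (by simp)]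

/-- `a_λ x b_λ` is a multiple of the Young symmetrizer. -/
theorem stabSum_mul_mul_colSum (lam : d.Partition) (x : GroupAlg d) :
    stabSum (rowOf lam) * x * colSum lam =
      (stabSum (rowOf lam) * x * colSum lam).coeff 1 • youngSymmetrizer lam := by
  suffices h : ∃ t : ℂ, stabSum (rowOf lam) * x * colSum lam = t • youngSymmetrizer lam by
    obtain ⟨t, ht⟩ := h
    rw [ht, MonoidAlgebra.coeff_smul, Finsupp.smul_apply, youngSymmetrizer_coeff_one, smul_eq_mul,
      mul_one]
  have key : ∀ g, ∃ t : ℂ, stabSum (rowOf lam) * elt g * colSum lam = t • youngSymmetrizer lam := by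
    intro g
    by_cases hg : ∀ i j, (rowOf lam ∘ g) i = (rowOf lam ∘ g) j → colOf lam i = colOf lam j → i = j
    · obtain ⟨q, hq, hq'⟩ := exists_col_perm lam (rowOf lam ∘ g) hg fun r => by
        rw [card_comp_perm (rowOf lam) g (· = r), card_rowOf_eq]
      -- With `g * q` preserving the rows and `q` the columns, the first is absorbed by the row sum
      -- and `q⁻¹` leaves its sign.
      have hg' : elt g = elt (g * q) * elt q⁻¹ := by
        rw [← elt_mul]; congr 1; group
      have hqi : ∀ i, colOf lam (q⁻¹ i) = colOf lam i := fun i => by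
        rw [← hq (q⁻¹ i)]; simp
      refine ⟨((Equiv.Perm.sign q⁻¹ : ℤ) : ℂ), ?_⟩
      rw [hg', ← mul_assoc, stabSum_mul_elt_of_stab (by simpa using hq'), mul_assoc,
        elt_mul_colSum hqi, mul_smul_comm, ← youngSymmetrizer_eq]
    · push Not at hg
      obtain ⟨i, j, h1, h2, h3⟩ := hg
      refine ⟨0, ?_⟩
      rw [stabSum_mul_elt, mul_assoc, stabSum_mul_colSum_eq_zero h3 h1 h2, mul_zero, zero_smul]
  choose t ht using key
  refine ⟨∑ g, x.coeff g * t g, ?_⟩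
  conv_lhs => rw [← sum_coeff_smul_elt x]
  rw [mul_sum, sum_mul, sum_smul]
  refine sum_congr rfl fun g _ => ?_
  rw [mul_smul_comm, smul_mul_assoc, ht, smul_smul]

theorem youngSymmetrizer_mul_mul (lam : d.Partition) (x : GroupAlg d) :
    youngSymmetrizer lam * x * youngSymmetrizer lam =
      (youngSymmetrizer lam * x * youngSymmetrizer lam).coeff 1 • youngSymmetrizer lam := by
  have h := stabSum_mul_mul_colSum lam (colSum lam * x * stabSum (rowOf lam))
  have e : stabSum (rowOf lam) * (colSum lam * x * stabSum (rowOf lam)) * colSum lam =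
      youngSymmetrizer lam * x * youngSymmetrizer lam := by
    rw [youngSymmetrizer_eq]; simp only [mul_assoc]
  rw [← e]
  exact h

/-- The scalar `n_λ` with `c_λ ^ 2 = n_λ c_λ`. -/
def hookScalar (lam : d.Partition) : ℂ := (youngSymmetrizer lam * youngSymmetrizer lam).coeff 1

theorem youngSymmetrizer_mul_self (lam : d.Partition) :
    youngSymmetrizer lam * youngSymmetrizer lam = hookScalar lam • youngSymmetrizer lam := by
  have h := youngSymmetrizer_mul_mul lam 1
  rwa [mul_one] at h

/-! ### Characters as traces on the group algebra, and their orthogonality. -/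

theorem trace_eq_sum_coeff (T : GroupAlg d →ₗ[ℂ] GroupAlg d) :
    LinearMap.trace ℂ (GroupAlg d) T = ∑ h, (T (elt h)).coeff h := by
  classical
  rw [LinearMap.trace_eq_matrix_trace ℂ (MonoidAlgebra.basis (Equiv.Perm (Fin d)) ℂ), Matrix.trace]
  refine sum_congr rfl fun h _ => ?_
  rw [Matrix.diag_apply, LinearMap.toMatrix_apply]
  rfl

/-- If $c_\lambda^2=0$, right multiplication by $c_\lambda$ is nilpotent and has trace zero. But its
trace is $d!$ times the coefficient of $c_\lambda$ at the identity, which is $d!$. -/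
theorem hookScalar_ne_zero (lam : d.Partition) : hookScalar lam ≠ 0 := by
  intro h0
  have hsq := youngSymmetrizer_mul_self lam
  rw [h0, zero_smul] at hsq
  have hnil : IsNilpotent (LinearMap.mulRight ℂ (youngSymmetrizer lam)) := by
    refine ⟨2, ?_⟩
    rw [LinearMap.pow_mulRight, pow_two, hsq]
    ext; simp
  have htr := (LinearMap.isNilpotent_trace_of_isNilpotent hnil).eq_zero
  rw [trace_eq_sum_coeff] at htr
  simp only [LinearMap.mulRight_apply, coeff_elt_mul, inv_mul_cancel, youngSymmetrizer_coeff_one,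
    sum_const, card_univ, nsmul_eq_mul, mul_one, Nat.cast_eq_zero] at htr
  exact Fintype.card_ne_zero htr

/-- Since $c_\lambda^2=n_\lambda c_\lambda$, the map $x\mapsto n_\lambda^{-1}xc_\lambda$ projects
the group algebra onto $H_\lambda$. So $\chi_\lambda(g)$ is the trace of $x\mapsto
n_\lambda^{-1}gxc_\lambda$ on the whole group algebra, computed in the basis of permutations. -/
theorem hookScalar_mul_chi (lam : d.Partition) (g : Equiv.Perm (Fin d)) :
    hookScalar lam * chi lam g = ∑ h, (youngSymmetrizer lam).coeff (h⁻¹ * g⁻¹ * h) := by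
  set c := youngSymmetrizer lam with hc
  let p : Submodule ℂ (GroupAlg d) := (H lam).restrictScalars ℂ
  let φ : GroupAlg d →ₗ[ℂ] GroupAlg d :=
    (hookScalar lam)⁻¹ • (LinearMap.mulLeft ℂ (elt g) ∘ₗ LinearMap.mulRight ℂ c)
  have hφ : ∀ x, φ x = (hookScalar lam)⁻¹ • (elt g * (x * c)) := fun x => rfl
  have hmem : ∀ x, φ x ∈ p := by
    intro x
    rw [hφ]
    refine p.smul_mem _ ?_
    change _ ∈ H lam
    rw [← mul_assoc]
    exact Submodule.smul_mem _ _ (Submodule.subset_span rfl)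
  have hres : rep lam g =
      (show H lam →ₗ[ℂ] H lam from φ.restrict (p := p) (q := p) fun x _ => hmem x) := by
    refine LinearMap.ext fun ⟨x, hx⟩ => Subtype.ext ?_
    have hx' : x ∈ Submodule.span (GroupAlg d) {c} := hx
    obtain ⟨y, rfl⟩ := Submodule.mem_span_singleton.1 hx'
    have h1 : ((rep lam g ⟨y • c, hx⟩ : H lam) : GroupAlg d) = elt g * (y • c) := rfl
    have h2 : (((show H lam →ₗ[ℂ] H lam from φ.restrict (p := p) (q := p) fun x _ => hmem x)
        ⟨y • c, hx⟩ : H lam) : GroupAlg d) = φ (y • c) := rfl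
    rw [h1, h2, hφ, smul_eq_mul, mul_assoc y, hc,
      youngSymmetrizer_mul_self, mul_smul_comm, mul_smul_comm, smul_smul,
      inv_mul_cancel₀ (hookScalar_ne_zero lam), one_smul]
  have htr : chi lam g = LinearMap.trace ℂ (GroupAlg d) φ := by
    rw [← LinearMap.trace_restrict_eq_of_forall_mem p φ hmem, chi, Representation.character, hres]
    rfl
  rw [htr, trace_eq_sum_coeff, mul_sum]
  refine sum_congr rfl fun h _ => ?_
  rw [hφ, MonoidAlgebra.coeff_smul, Finsupp.smul_apply, smul_eq_mul, ← mul_assoc,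
    mul_inv_cancel₀ (hookScalar_ne_zero lam), one_mul, coeff_elt_mul, coeff_elt_mul, mul_assoc]

theorem chi_conj (lam : d.Partition) (g h : Equiv.Perm (Fin d)) :
    chi lam (h * g * h⁻¹) = chi lam g :=
  Representation.char_conj _ _ _

theorem chi_eq_of_isConj (lam : d.Partition) {g g' : Equiv.Perm (Fin d)} (h : IsConj g g') :
    chi lam g = chi lam g' := by
  obtain ⟨k, rfl⟩ := isConj_iff.1 h
  rw [chi_conj]

/-- A permutation and its inverse have the same cycle type. This makes the orthogonality relations
hold without complex conjugation. -/
theorem chi_inv (lam : d.Partition) (g : Equiv.Perm (Fin d)) : chi lam g⁻¹ = chi lam g :=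
  chi_eq_of_isConj lam (Equiv.Perm.isConj_of_cycleType_eq (Equiv.Perm.cycleType_inv g))

theorem coeff_mul_apply_eq_sum (x y : GroupAlg d) (k : Equiv.Perm (Fin d)) :
    (x * y).coeff k = ∑ g, x.coeff g * y.coeff (g⁻¹ * k) := by
  conv_lhs => rw [← sum_coeff_smul_elt x]
  rw [sum_mul, MonoidAlgebra.coeff_sum, Finsupp.finsetSum_apply]
  refine sum_congr rfl fun g _ => ?_
  rw [smul_mul_assoc, MonoidAlgebra.coeff_smul, Finsupp.smul_apply, coeff_elt_mul, smul_eq_mul]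

/-- As $xkc$ is a multiple of $c$, its coefficient at $k$ is $c_k$ times its coefficient at $1$;
summing over $k$ reassembles the middle factor $c$. -/
theorem sum_coeff_mul_mul (x : GroupAlg d) {c : GroupAlg d}
    (hc : ∀ y, x * y * c = (x * y * c).coeff 1 • c) :
    ∑ k, (x * elt k * c).coeff k = (x * c * c).coeff 1 := by
  have h1 : ∀ k, (x * elt k * c).coeff k = (c.coeff k • (x * elt k * c)).coeff 1 := by
    intro k
    conv_lhs => rw [hc]
    simp only [MonoidAlgebra.coeff_smul, Finsupp.smul_apply, smul_eq_mul]
    rw [mul_comm]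
  simp_rw [h1]
  rw [← Finsupp.finsetSum_apply, ← MonoidAlgebra.coeff_sum]
  congr 2
  conv_rhs => rw [mul_assoc, ← sum_coeff_smul_elt c, sum_mul, mul_sum]
  rw [sum_coeff_smul_elt]
  refine sum_congr rfl fun k _ => ?_
  rw [smul_mul_assoc, mul_smul_comm, mul_assoc]

theorem hookScalar_mul_sum_chi_mul_chi (lam mu : d.Partition) :
    hookScalar lam * hookScalar mu * ∑ g, chi lam g * chi mu g =
      Fintype.card (Equiv.Perm (Fin d)) *
        ∑ k, (youngSymmetrizer lam * elt k * youngSymmetrizer mu).coeff k := by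
  set c := youngSymmetrizer lam
  set c' := youngSymmetrizer mu
  -- After conjugation of the summation variable by `h⁻¹`, the sum is a convolution that depends
  -- only on `h⁻¹ * k`; this is why the outer sum over `h` just gives the order of the group.
  have h1 : ∀ h k : Equiv.Perm (Fin d), ∑ g, c.coeff (h⁻¹ * g⁻¹ * h) * c'.coeff (k⁻¹ * g * k) =
      (c * elt (h⁻¹ * k) * c').coeff (h⁻¹ * k) := by
    intro h k
    rw [mul_assoc, coeff_mul_apply_eq_sum]
    refine Fintype.sum_equiv ((Equiv.inv _).trans (MulAut.conj h⁻¹).toEquiv) _ _ fun g => ?_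
    rw [coeff_elt_mul]
    simp [mul_assoc]
  calc hookScalar lam * hookScalar mu * ∑ g, chi lam g * chi mu g
      = ∑ g, (hookScalar lam * chi lam g) * (hookScalar mu * chi mu g⁻¹) := by
        rw [mul_sum]
        refine sum_congr rfl fun g _ => ?_
        rw [chi_inv]; ring
    _ = ∑ g, ∑ h, ∑ k, c.coeff (h⁻¹ * g⁻¹ * h) * c'.coeff (k⁻¹ * g * k) := by
        refine sum_congr rfl fun g _ => ?_
        rw [hookScalar_mul_chi, hookScalar_mul_chi, sum_mul_sum, inv_inv]
    _ = ∑ h, ∑ k, (c * elt (h⁻¹ * k) * c').coeff (h⁻¹ * k) := by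
        rw [sum_comm]
        refine sum_congr rfl fun h _ => ?_
        rw [sum_comm]
        exact sum_congr rfl fun k _ => h1 h k
    _ = ∑ _h : Equiv.Perm (Fin d), ∑ k, (c * elt k * c').coeff k := by
        refine sum_congr rfl fun h _ => ?_
        exact Fintype.sum_equiv (Equiv.mulLeft h⁻¹) _ _ fun k => rfl
    _ = _ := by rw [sum_const, card_univ, nsmul_eq_mul]

/-- The characters `χ_λ` are orthonormal. -/
theorem sum_chi_mul_chi (lam mu : d.Partition) :
    ∑ g, chi lam g * chi mu g = if lam = mu then (Fintype.card (Equiv.Perm (Fin d)) : ℂ) else 0 := by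
  have hne : ∀ lam mu : d.Partition, ¬ Dominated lam mu → ∑ g, chi lam g * chi mu g = 0 := by
    intro lam mu h
    have h1 := hookScalar_mul_sum_chi_mul_chi lam mu
    simp only [youngSymmetrizer_mul_mul_eq_zero h, MonoidAlgebra.coeff_zero, Finsupp.coe_zero,
      Pi.zero_apply, sum_const_zero, mul_zero] at h1
    exact (mul_eq_zero.1 h1).resolve_left
      (mul_ne_zero (hookScalar_ne_zero _) (hookScalar_ne_zero _))
  split_ifs with h
  · subst h
    have h1 := hookScalar_mul_sum_chi_mul_chi lam lam
    rw [sum_coeff_mul_mul _ (youngSymmetrizer_mul_mul lam), youngSymmetrizer_mul_self,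
      smul_mul_assoc, youngSymmetrizer_mul_self, smul_smul, MonoidAlgebra.coeff_smul,
      Finsupp.smul_apply, youngSymmetrizer_coeff_one, smul_eq_mul, mul_one, mul_comm] at h1
    exact mul_right_cancel₀ (mul_ne_zero (hookScalar_ne_zero lam) (hookScalar_ne_zero lam)) h1
  -- Dominance is antisymmetric, so it fails in one of the two directions, and the sum is symmetric.
  · by_cases h1 : Dominated lam mu
    · have h2 : ¬ Dominated mu lam := fun h2 => h (h1.antisymm h2)
      rw [← hne mu lam h2]
      exact sum_congr rfl fun g _ => mul_comm _ _
    · exact hne lam mu h1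

/-! ### Averages of characters over stabilizers of colourings. -/

theorem hookScalar_mul_sum_stab_chi (f : Fin d → ℕ) (mu : d.Partition) :
    hookScalar mu * ∑ g : Equiv.Perm (Fin d) with ∀ i, f (g i) = f i, chi mu g =
      ∑ k, (stabSum f * elt k * youngSymmetrizer mu).coeff k := by
  rw [mul_sum]
  simp_rw [hookScalar_mul_chi]
  rw [sum_comm]
  refine sum_congr rfl fun k _ => ?_
  rw [stabSum, sum_mul, sum_mul, MonoidAlgebra.coeff_sum, Finsupp.finsetSum_apply]
  refine sum_congr rfl fun g _ => ?_
  rw [mul_assoc (elt g), coeff_elt_mul, coeff_elt_mul, mul_assoc]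

theorem sum_stab_chi_eq_zero {f : Fin d → ℕ} {mu : d.Partition}
    (h : ¬ ∀ k, #{i | f i < k} ≤ ∑ r ∈ range k, part mu r) :
    ∑ g : Equiv.Perm (Fin d) with ∀ i, f (g i) = f i, chi mu g = 0 := by
  have h1 := hookScalar_mul_sum_stab_chi f mu
  have h2 : ∀ k, stabSum f * elt k * youngSymmetrizer mu = 0 := by
    intro k
    have := stabSum_mul_mul_colSum_eq_zero h (elt k * stabSum (rowOf mu))
    rw [youngSymmetrizer_eq]
    simpa only [mul_assoc] using this
  simp only [h2, MonoidAlgebra.coeff_zero, Finsupp.coe_zero, Pi.zero_apply, sum_const_zero] at h1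
  exact (mul_eq_zero.1 h1).resolve_left (hookScalar_ne_zero _)

theorem stabSum_mul_self (f : Fin d → ℕ) :
    stabSum f * stabSum f =
      (#{g : Equiv.Perm (Fin d) | ∀ i, f (g i) = f i} : ℂ) • stabSum f := by
  conv_lhs => enter [2]; rw [stabSum]
  rw [mul_sum, sum_congr rfl fun p hp => stabSum_mul_elt_of_stab (by simpa using hp), sum_const,
    Nat.cast_smul_eq_nsmul]

/-- In terms of representations: the vectors of $H_\mu$ invariant under the row group form a line.
The computation only uses that $a_\mu yc_\mu$ is a multiple of $c_\mu$, with $a_\mu$ the row sum. -/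
theorem sum_stab_rowOf_chi (mu : d.Partition) :
    ∑ g : Equiv.Perm (Fin d) with ∀ i, rowOf mu (g i) = rowOf mu i, chi mu g =
      #{g : Equiv.Perm (Fin d) | ∀ i, rowOf mu (g i) = rowOf mu i} := by
  have h1 := hookScalar_mul_sum_stab_chi (rowOf mu) mu
  have h2 : ∀ y, stabSum (rowOf mu) * y * youngSymmetrizer mu =
      (stabSum (rowOf mu) * y * youngSymmetrizer mu).coeff 1 • youngSymmetrizer mu := by
    intro y
    have := stabSum_mul_mul_colSum mu (y * stabSum (rowOf mu))
    rw [← mul_assoc, mul_assoc (stabSum (rowOf mu) * y), ← youngSymmetrizer_eq] at this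
    exact this
  have h3 : stabSum (rowOf mu) * youngSymmetrizer mu =
      (#{g : Equiv.Perm (Fin d) | ∀ i, rowOf mu (g i) = rowOf mu i} : ℂ) •
        youngSymmetrizer mu := by
    rw [youngSymmetrizer_eq, ← mul_assoc, stabSum_mul_self, smul_mul_assoc]
  rw [sum_coeff_mul_mul _ h2, h3, smul_mul_assoc, youngSymmetrizer_mul_self, smul_smul,
    MonoidAlgebra.coeff_smul, Finsupp.smul_apply, youngSymmetrizer_coeff_one, smul_eq_mul, mul_one,
    mul_comm] at h1
  exact mul_right_cancel₀ (hookScalar_ne_zero mu) h1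

theorem sum_stab_chi_eq_card {f : Fin d → ℕ} {mu : d.Partition}
    (h : ∀ r, #{i | f i = r} = part mu r) :
    ∑ g : Equiv.Perm (Fin d) with ∀ i, f (g i) = f i, chi mu g =
      #{g : Equiv.Perm (Fin d) | ∀ i, f (g i) = f i} := by
  obtain ⟨s, hs⟩ := exists_perm_comp_eq (rowOf mu) f fun r => by rw [card_rowOf_eq, h]
  have key : ∀ φ : Equiv.Perm (Fin d) → ℂ, (∀ g, φ (s * g * s⁻¹) = φ g) →
      ∑ g : Equiv.Perm (Fin d) with ∀ i, f (g i) = f i, φ g =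
      ∑ g : Equiv.Perm (Fin d) with ∀ i, rowOf mu (g i) = rowOf mu i, φ g := by
    intro φ hφ
    refine sum_nbij' (fun g => s * g * s⁻¹) (fun g => s⁻¹ * g * s) ?_ ?_ ?_ ?_ ?_
    · intro g hg
      simp only [mem_filter, mem_univ, true_and] at hg ⊢
      intro i
      have := hg (s⁻¹ i)
      rw [← hs, ← hs] at this
      simpa using this
    · intro g hg
      simp only [mem_filter, mem_univ, true_and] at hg ⊢
      intro i
      rw [← hs, ← hs]
      simpa using hg (s i)
    · intro g _; group
    · intro g _; group
    · intro g _; rw [hφ]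
  rw [key _ fun g => chi_conj mu g s, sum_stab_rowOf_chi]
  have := key (fun _ => 1) fun _ => rfl
  simpa using this.symm

end GroupAlgebra

end TypeI

end

noncomputable section

namespace TypeI

open Finset MvPolynomial

/-! ### Alternating polynomials -/

section Alternants

variable {R : Type*} [CommRing R] {N : ℕ}

/-- The alternant with exponents `e`, over any ring. -/
def altDet (R : Type*) [CommRing R] {N : ℕ} (e : Fin N → ℕ) : MvPolynomial (Fin N) R :=
  (Matrix.of fun i j : Fin N => (X i : MvPolynomial (Fin N) R) ^ e j).det

/-- The exponents `λ_j + N - 1 - j`. -/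
def expo (N : ℕ) {d : ℕ} (lam : d.Partition) : Fin N →₀ ℕ :=
  Finsupp.equivFunOnFinite.symm fun j => part lam j + (N - 1 - j)

/-- The exponents `N - 1 - j`. -/
def stair (N : ℕ) : Fin N →₀ ℕ := Finsupp.equivFunOnFinite.symm fun j => N - 1 - j

theorem expo_apply {d : ℕ} (lam : d.Partition) (j : Fin N) :
    expo N lam j = part lam j + (N - 1 - j) := rfl

theorem stair_apply (j : Fin N) : stair N j = N - 1 - j := rfl

theorem alternant_part {d : ℕ} (lam : d.Partition) :
    alternant N (part lam) = altDet ℤ (expo N lam) := rfl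

theorem alternant_zero : alternant N (fun _ => 0) = altDet ℤ (stair N) := by
  simp only [alternant, altDet, zero_add]
  rfl

theorem prod_X_pow (m : Fin N →₀ ℕ) :
    ∏ i, (X i : MvPolynomial (Fin N) R) ^ m i = monomial m 1 := by
  rw [monomial_eq, C_1, one_mul, Finsupp.prod_fintype _ _ (by simp)]

theorem coeff_altDet (e : Fin N → ℕ) (m : Fin N →₀ ℕ) :
    coeff m (altDet R e) =
      ∑ w : Equiv.Perm (Fin N), if ∀ i, m (w i) = e i then ((Equiv.Perm.sign w : ℤ) : R) else 0 := by
  rw [altDet, Matrix.det_apply, coeff_sum]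
  refine sum_congr rfl fun w _ => ?_
  have h1 : ∏ i, (Matrix.of fun i j : Fin N => (X i : MvPolynomial (Fin N) R) ^ e j) (w i) i =
      monomial (Finsupp.equivFunOnFinite.symm fun i => e (w.symm i)) 1 := by
    rw [← prod_X_pow]
    refine Fintype.prod_equiv w _ _ fun i => ?_
    simp
  rw [h1, Units.smul_def, coeff_smul, coeff_monomial]
  have h2 : (Finsupp.equivFunOnFinite.symm (fun i => e (w.symm i)) = m) ↔ ∀ i, m (w i) = e i := by
    rw [DFunLike.ext_iff]
    constructor
    · intro h i
      rw [← h]; simp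
    · intro h i
      have := h (w.symm i)
      rw [Equiv.apply_symm_apply] at this
      rw [this]; rfl
  by_cases h : ∀ i, m (w i) = e i
  · rw [if_pos h, if_pos (h2.2 h)]; simp
  · rw [if_neg h, if_neg (mt h2.1 h)]; simp

theorem perm_eq_one_of_strictAnti {m : Fin N → ℕ} (hm : StrictAnti m) {w : Equiv.Perm (Fin N)}
    (hw : StrictAnti fun i => m (w i)) : w = 1 := by
  have h : Monotone w := fun i j hij => by
    by_contra hc
    exact absurd (hw.antitone hij) (not_le.2 (hm (not_le.1 hc)))
  exact (Equiv.Perm.monotone_iff w).1 h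

/-- Two strictly decreasing sequences are rearrangements of each other only if they are equal, and
then only through the identity; one term of the Leibniz expansion survives. -/
theorem coeff_altDet_of_strictAnti {e : Fin N → ℕ} {m : Fin N →₀ ℕ} (he : StrictAnti e)
    (hm : StrictAnti m) : coeff m (altDet R e) = if ⇑m = e then 1 else 0 := by
  rw [coeff_altDet, sum_eq_single_of_mem 1 (mem_univ _)]
  · simp only [Equiv.Perm.coe_one, id, Equiv.Perm.sign_one, Units.val_one, Int.cast_one]
    congr 1
    rw [funext_iff]
  · intro w _ hw
    rw [if_neg]
    intro h
    have h' : (fun i => m (w i)) = e := funext h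
    exact hw (perm_eq_one_of_strictAnti hm (h' ▸ he))

/-- A polynomial that changes by the sign under permutations of the variables. -/
def IsAlt (F : MvPolynomial (Fin N) R) : Prop :=
  ∀ w : Equiv.Perm (Fin N), rename w F = ((Equiv.Perm.sign w : ℤ) : MvPolynomial (Fin N) R) * F

theorem IsAlt.coeff_mapDomain {F : MvPolynomial (Fin N) R} (hF : IsAlt F) (w : Equiv.Perm (Fin N))
    (m : Fin N →₀ ℕ) :
    coeff m F = ((Equiv.Perm.sign w : ℤ) : R) * coeff (m.mapDomain w) F := by
  have h := coeff_rename_mapDomain w w.injective F m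
  rw [hF w, ← map_intCast (C : R →+* MvPolynomial (Fin N) R), coeff_C_mul] at h
  exact h.symm

theorem isAlt_altDet (e : Fin N → ℕ) : IsAlt (altDet R e) := by
  intro w
  rw [altDet, ← AlgHom.coe_toRingHom, RingHom.map_det]
  have h : (rename w : MvPolynomial (Fin N) R →ₐ[R] _).toRingHom.mapMatrix
      (Matrix.of fun i j : Fin N => (X i : MvPolynomial (Fin N) R) ^ e j) =
      (Matrix.of fun i j : Fin N => (X i : MvPolynomial (Fin N) R) ^ e j).submatrix w id := by
    ext1 i j
    simp
  exact (congrArg Matrix.det h).trans (Matrix.det_permute _ _)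

theorem IsAlt.sub {F G : MvPolynomial (Fin N) R} (hF : IsAlt F) (hG : IsAlt G) :
    IsAlt (F - G) := fun w => by rw [map_sub, hF, hG, mul_sub]

theorem IsAlt.sum {ι : Type*} (s : Finset ι) {F : ι → MvPolynomial (Fin N) R}
    (hF : ∀ i ∈ s, IsAlt (F i)) : IsAlt (∑ i ∈ s, F i) := fun w => by
  rw [map_sum, mul_sum]
  exact sum_congr rfl fun i hi => hF i hi w

theorem IsAlt.C_mul {F : MvPolynomial (Fin N) R} (hF : IsAlt F) (r : R) : IsAlt (C r * F) :=
  fun w => by rw [map_mul, hF, rename_C]; ring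

theorem IsAlt.mul_symmetric {F G : MvPolynomial (Fin N) R} (hF : IsAlt F) (hG : G.IsSymmetric) :
    IsAlt (F * G) := fun w => by rw [map_mul, hF, hG w, mul_assoc]

theorem isHomogeneous_altDet (e : Fin N → ℕ) : (altDet R e).IsHomogeneous (∑ i, e i) := by
  rw [altDet, Matrix.det_apply]
  refine IsHomogeneous.sum _ _ _ fun w _ => ?_
  rw [Units.smul_def, ← Int.cast_smul_eq_zsmul R, smul_eq_C_mul]
  exact (IsHomogeneous.prod _ _ _ fun i _ => isHomogeneous_X_pow _ _).C_mul _

theorem strictAnti_stair : StrictAnti (stair N) := by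
  intro i j hij
  rw [stair_apply, stair_apply]
  have := j.2
  have : (i : ℕ) < j := hij
  omega

theorem strictAnti_expo {d : ℕ} (lam : d.Partition) : StrictAnti (expo N lam) := by
  intro i j hij
  rw [expo_apply, expo_apply]
  exact add_lt_add_of_le_of_lt (part_antitone lam hij.le) (strictAnti_stair hij)

theorem sum_expo {d : ℕ} (lam : d.Partition) (hN : d ≤ N) :
    ∑ i, expo N lam i = d + ∑ i, stair N i := by
  simp_rw [expo_apply]
  rw [sum_add_distrib, Fin.sum_univ_eq_sum_range (part lam) N, sum_part lam hN]
  rfl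

theorem expo_injective {d : ℕ} (hN : d ≤ N) :
    Function.Injective (expo N : d.Partition → Fin N →₀ ℕ) := by
  intro lam mu h
  apply part_injective
  funext j
  rcases lt_or_ge j N with hj | hj
  · have := DFunLike.congr_fun h ⟨j, hj⟩
    rw [expo_apply, expo_apply] at this
    exact add_right_cancel this
  · rw [part_of_le lam (hN.trans hj), part_of_le mu (hN.trans hj)]

/-- A strictly decreasing sequence of naturals lies above the staircase, and subtracting the
staircase leaves a weakly decreasing one. -/
theorem exists_expo_eq {d : ℕ} {m : Fin N →₀ ℕ} (hm : StrictAnti m)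
    (hs : ∑ i, m i = d + ∑ i, stair N i) : ∃ lam : d.Partition, expo N lam = m := by
  have hge : ∀ k (hk : k < N), N - 1 - k ≤ m ⟨k, hk⟩ := by
    intro k hk
    induction hi : N - 1 - k generalizing k with
    | zero => exact Nat.zero_le _
    | succ i ih =>
      have h1 := ih (k + 1) (by omega) (by omega)
      have h2 : m ⟨k + 1, by omega⟩ < m ⟨k, hk⟩ := hm (Fin.mk_lt_mk.2 (Nat.lt_succ_self k))
      omega
  let f : ℕ → ℕ := fun k => if hk : k < N then m ⟨k, hk⟩ - (N - 1 - k) else 0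
  have hfm : ∀ i : Fin N, f i + stair N i = m i := by
    intro i
    have := hge i i.2
    simp only [f, i.2, dif_pos, stair_apply, Fin.eta] at this ⊢
    omega
  have hf : Antitone f := by
    refine antitone_nat_of_succ_le fun k => ?_
    by_cases hk : k + 1 < N
    · have h1 := hfm ⟨k + 1, hk⟩
      have h2 := hfm ⟨k, by omega⟩
      have h3 : m ⟨k + 1, hk⟩ < m ⟨k, by omega⟩ := hm (Fin.mk_lt_mk.2 (Nat.lt_succ_self k))
      simp only [stair_apply] at h1 h2
      omega
    · simp [f, hk]
  obtain ⟨lam, hlam⟩ := exists_part_eq (d := d) f hf N (by simp [f]) (by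
    rw [← Fin.sum_univ_eq_sum_range f N]
    have : ∑ i, m i = ∑ i : Fin N, f i + ∑ i, stair N i := by
      rw [← sum_add_distrib]; exact sum_congr rfl fun i _ => (hfm i).symm
    omega)
  refine ⟨lam, Finsupp.ext fun i => ?_⟩
  rw [expo_apply, hlam]
  exact hfm i

theorem degree_eq_sum_univ (m : Fin N →₀ ℕ) : m.degree = ∑ i, m i :=
  Finsupp.degree_eq_sum m

/-- An injective exponent is a rearrangement of a strictly decreasing one, so its coefficient is
known up to sign. A non-injective exponent is fixed by a transposition, so its coefficient equals
its own negative. -/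
theorem IsAlt.eq_zero [IsDomain R] [CharZero R] {F : MvPolynomial (Fin N) R} (hF : IsAlt F)
    (h : ∀ m : Fin N →₀ ℕ, StrictAnti m → coeff m F = 0) : F = 0 := by
  ext m
  rw [coeff_zero]
  by_cases hm : Function.Injective m
  · set s := Tuple.sort m
    have hmono : Monotone (m ∘ s) := Tuple.monotone_sort m
    have hstrict : StrictMono (m ∘ s) := hmono.strictMono_of_injective (hm.comp s.injective)
    -- `Tuple.sort` sorts increasingly, hence the reversal.
    let t : Equiv.Perm (Fin N) := (Fin.revPerm.trans s).symm
    rw [hF.coeff_mapDomain t, h, mul_zero]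
    intro i j hij
    have e : ∀ i, m.mapDomain t i = m (s (Fin.rev i)) := by
      intro i
      have : i = t (s (Fin.rev i)) := by simp [t]
      conv_lhs => rw [this]
      rw [Finsupp.mapDomain_apply t.injective]
    rw [e, e]
    exact hstrict (Fin.rev_lt_rev.2 hij)
  · simp only [Function.Injective, not_forall] at hm
    obtain ⟨i, j, hmij, hij⟩ := hm
    have h1 := hF.coeff_mapDomain (Equiv.swap i j) m
    have h2 : m.mapDomain (Equiv.swap i j) = m := by
      ext k
      have : k = Equiv.swap i j (Equiv.swap i j k) := by simp
      conv_lhs => rw [this]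
      rw [Finsupp.mapDomain_apply (Equiv.swap i j).injective]
      rcases eq_or_ne k i with rfl | hki
      · rw [Equiv.swap_apply_left, hmij]
      rcases eq_or_ne k j with rfl | hkj
      · rw [Equiv.swap_apply_right, hmij]
      rw [Equiv.swap_apply_of_ne_of_ne hki hkj]
    rw [h2, Equiv.Perm.sign_swap hij] at h1
    simp only [Units.val_neg, Units.val_one, Int.cast_neg, Int.cast_one, neg_mul, one_mul] at h1
    exact self_eq_neg.1 h1

theorem coeff_expo_altDet_expo {d : ℕ} (hN : d ≤ N) (lam mu : d.Partition) :
    coeff (expo N lam) (altDet R (expo N mu)) = if lam = mu then 1 else 0 := by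
  rw [coeff_altDet_of_strictAnti (strictAnti_expo mu) (strictAnti_expo lam)]
  congr 1
  rw [DFunLike.coe_fn_eq, (expo_injective hN).eq_iff]

/-- The alternants of the partitions of `d` span the alternating polynomials of the
corresponding degree. -/
theorem IsAlt.eq_sum [IsDomain R] [CharZero R] {F : MvPolynomial (Fin N) R} (hF : IsAlt F)
    {d : ℕ} (hN : d ≤ N) (hd : F.IsHomogeneous (d + ∑ i, stair N i)) :
    F = ∑ lam : d.Partition, C (coeff (expo N lam) F) * altDet R (expo N lam) := by
  rw [← sub_eq_zero]
  refine IsAlt.eq_zero (hF.sub (IsAlt.sum _ fun lam _ => (isAlt_altDet _).C_mul _)) fun m hm => ?_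
  by_cases hdeg : ∑ i, m i = d + ∑ i, stair N i
  · obtain ⟨mu, rfl⟩ := exists_expo_eq hm hdeg
    rw [coeff_sub, coeff_sum]
    simp_rw [coeff_C_mul, coeff_expo_altDet_expo hN]
    simp
  · refine IsHomogeneous.coeff_eq_zero (hd.sub (IsHomogeneous.sum _ _ _ fun lam _ => ?_))
      (by rwa [degree_eq_sum_univ])
    rw [← sum_expo lam hN]
    exact (isHomogeneous_altDet _).C_mul _

theorem altDet_stair_eq : altDet R (stair N) =
    (Matrix.of fun i j : Fin N => (X i : MvPolynomial (Fin N) R) ^ ((Fin.rev j : Fin N) : ℕ)).det := by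
  rw [altDet]
  congr 1
  ext1 i j
  rw [Matrix.of_apply, Matrix.of_apply, stair_apply, Fin.val_rev]
  congr 1
  omega

theorem altDet_stair_ne_zero [Nontrivial R] : altDet R (stair N) ≠ 0 := by
  intro h
  have := coeff_altDet_of_strictAnti (R := R) (strictAnti_stair (N := N)) (strictAnti_stair (N := N))
  rw [h, coeff_zero, if_pos rfl] at this
  exact zero_ne_one this

/-- Every alternant is divisible by the Vandermonde determinant. -/
theorem altDet_stair_dvd (e : Fin N → ℕ) : altDet R (stair N) ∣ altDet R e := by
  nontriviality R
  -- All variables are roots of the monic `P`, so reducing $T^{e_j}$ modulo `P` keeps its values at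
  -- the variables and brings the degree below `N`. The matrix of powers then factors through the
  -- Vandermonde matrix.
  let P : Polynomial (MvPolynomial (Fin N) R) := ∏ i, (Polynomial.X - Polynomial.C (X i))
  have hP : P.Monic := Polynomial.monic_prod_of_monic _ _ fun i _ => Polynomial.monic_X_sub_C _
  have hdeg : P.natDegree = N := by
    rw [Polynomial.natDegree_prod_of_monic _ _ fun i _ => Polynomial.monic_X_sub_C _]
    simp
  have hPe : ∀ i, P.eval (X i) = 0 := by
    intro i
    rw [Polynomial.eval_prod]
    exact prod_eq_zero (mem_univ i) (by simp)
  let Q : Fin N → Polynomial (MvPolynomial (Fin N) R) := fun j => Polynomial.X ^ e j %ₘ P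
  have hQe : ∀ i j, (Q j).eval (X i) = X i ^ e j := by
    intro i j
    have h := congrArg (Polynomial.eval (X i)) (Polynomial.modByMonic_add_div (Polynomial.X ^ e j) P)
    rw [Polynomial.eval_add, Polynomial.eval_mul, hPe, zero_mul, add_zero] at h
    simpa using h
  have hQd : ∀ j, (Q j).natDegree < N ∨ N = 0 := by
    intro j
    rcases Nat.eq_zero_or_pos N with h0 | hpos
    · exact Or.inr h0
    · left
      have := Polynomial.natDegree_modByMonic_lt (Polynomial.X ^ e j) hP (by
        intro h1
        rw [h1, Polynomial.natDegree_one] at hdeg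
        omega)
      rwa [hdeg] at this
  have hfac : (Matrix.of fun i j : Fin N => (X i : MvPolynomial (Fin N) R) ^ e j) =
      (Matrix.of fun i j : Fin N => (X i : MvPolynomial (Fin N) R) ^ ((Fin.rev j : Fin N) : ℕ)) *
        Matrix.of fun k j : Fin N => (Q j).coeff (Fin.rev k : Fin N) := by
    ext1 i j
    rw [Matrix.mul_apply, Matrix.of_apply, ← hQe]
    have hlt : (Q j).natDegree < N := (hQd j).resolve_right fun h => by
      have := i.2
      omega
    rw [Polynomial.eval_eq_sum_range' hlt, ← Fin.sum_univ_eq_sum_range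
      (fun k => (Q j).coeff k * X i ^ k) N]
    refine (Fintype.sum_equiv Fin.revPerm _ _ fun k => ?_).symm
    simp [mul_comm]
  conv_rhs => rw [altDet, hfac, Matrix.det_mul, ← altDet_stair_eq]
  exact dvd_mul_right _ _

theorem homogeneousComponent_mul_of_isHomogeneous {F : MvPolynomial (Fin N) R} {m : ℕ}
    (hF : F.IsHomogeneous m) (n : ℕ) (G : MvPolynomial (Fin N) R) :
    homogeneousComponent (m + n) (F * G) = F * homogeneousComponent n G := by
  have h : ∀ i, homogeneousComponent (m + n) (F * homogeneousComponent i G) =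
      if i = n then F * homogeneousComponent n G else 0 := by
    intro i
    rw [homogeneousComponent_of_mem ((mem_homogeneousSubmodule _ _).2
      (hF.mul (homogeneousComponent_isHomogeneous i G)))]
    by_cases hi : i = n
    · subst hi; simp
    · rw [if_neg hi, if_neg]; omega
  conv_lhs => rw [← sum_homogeneousComponent G, mul_sum, map_sum]
  simp_rw [h]
  rw [sum_ite_eq']
  split_ifs with hn
  · rfl
  · rw [homogeneousComponent_eq_zero _ _ (by simpa [Nat.lt_succ_iff] using hn), mul_zero]

end Alternants

/-! ### Schur polynomials -/

section SchurPolynomials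

variable {N : ℕ}

/-- The Schur polynomial `s_λ(x_1, …, x_N)`. -/
def schurPoly (N : ℕ) {d : ℕ} (lam : d.Partition) : MvPolynomial (Fin N) ℤ :=
  homogeneousComponent d (altDet_stair_dvd (R := ℤ) (expo N lam)).choose

theorem isHomogeneous_schurPoly {d : ℕ} (lam : d.Partition) :
    (schurPoly N lam).IsHomogeneous d := homogeneousComponent_isHomogeneous _ _

/-- Both alternants are homogeneous and their degrees differ by `d`, so replacing the chosen
quotient by its component of degree `d` keeps the product. -/
theorem altDet_stair_mul_schurPoly {d : ℕ} (hN : d ≤ N) (lam : d.Partition) :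
    altDet ℤ (stair N) * schurPoly N lam = altDet ℤ (expo N lam) := by
  rw [schurPoly, ← homogeneousComponent_mul_of_isHomogeneous (isHomogeneous_altDet _),
    ← (altDet_stair_dvd (R := ℤ) (expo N lam)).choose_spec]
  refine homogeneousComponent_eq_self ?_
  rw [add_comm, ← sum_expo lam hN]
  exact isHomogeneous_altDet _

theorem isSymmetric_schurPoly {d : ℕ} (hN : d ≤ N) (lam : d.Partition) :
    (schurPoly N lam).IsSymmetric := by
  intro w
  have h := isAlt_altDet (R := ℤ) (expo N lam) w
  rw [← altDet_stair_mul_schurPoly hN, map_mul, isAlt_altDet, mul_assoc] at h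
  have hs : ((Equiv.Perm.sign w : ℤ) : MvPolynomial (Fin N) ℤ) ≠ 0 := by
    rcases Int.units_eq_one_or (Equiv.Perm.sign w) with h | h <;> simp [h]
  exact mul_left_cancel₀ altDet_stair_ne_zero (mul_left_cancel₀ hs h)

/-- The coefficient of `s_λ` in the Schur expansion of a symmetric polynomial. -/
def schurCoeff (N : ℕ) {d : ℕ} (lam : d.Partition) : MvPolynomial (Fin N) ℤ →ₗ[ℤ] ℤ :=
  lcoeff ℤ (expo N lam) ∘ₗ LinearMap.mulLeft ℤ (altDet ℤ (stair N))

theorem schurCoeff_apply {d : ℕ} (lam : d.Partition) (F : MvPolynomial (Fin N) ℤ) :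
    schurCoeff N lam F = coeff (expo N lam) (altDet ℤ (stair N) * F) := rfl

theorem schurCoeff_schurPoly {d : ℕ} (hN : d ≤ N) (lam mu : d.Partition) :
    schurCoeff N lam (schurPoly N mu) = if lam = mu then 1 else 0 := by
  rw [schurCoeff_apply, altDet_stair_mul_schurPoly hN, coeff_expo_altDet_expo hN]

theorem schurCoeff_eq_zero {d m : ℕ} (hN : d ≤ N) (lam : d.Partition)
    {F : MvPolynomial (Fin N) ℤ} (hF : F.IsHomogeneous m) (h : m ≠ d) :
    schurCoeff N lam F = 0 := by
  refine ((isHomogeneous_altDet _).mul hF).coeff_eq_zero ?_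
  rw [degree_eq_sum_univ, sum_expo lam hN]
  omega

/-- The Schur expansion of a symmetric homogeneous polynomial. -/
theorem eq_sum_schurCoeff {d : ℕ} (hN : d ≤ N) {F : MvPolynomial (Fin N) ℤ} (hs : F.IsSymmetric)
    (hF : F.IsHomogeneous d) : F = ∑ lam : d.Partition, schurCoeff N lam F • schurPoly N lam := by
  apply mul_left_cancel₀ (altDet_stair_ne_zero (R := ℤ) (N := N))
  have h := ((isAlt_altDet (R := ℤ) (stair N)).mul_symmetric hs).eq_sum hN
    (add_comm d _ ▸ (isHomogeneous_altDet (R := ℤ) (stair N)).mul hF)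
  rw [h, mul_sum]
  refine sum_congr rfl fun lam _ => ?_
  rw [mul_smul_comm, altDet_stair_mul_schurPoly hN, schurCoeff_apply, smul_eq_C_mul]

theorem schur_eq {d : ℕ} (hN : d ≤ N) (lam : d.Partition) :
    schur N lam = algebraMap _ (FractionRing (MvPolynomial (Fin N) ℤ)) (schurPoly N lam) := by
  rw [schur, alternant_part, alternant_zero, ← altDet_stair_mul_schurPoly hN, map_mul,
    mul_div_cancel_left₀]
  rw [Ne, FaithfulSMul.algebraMap_eq_zero_iff]
  exact altDet_stair_ne_zero

theorem isSchurExpansion_iff (al be : Ptn) (c : Ptn → ℤ) :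
    IsSchurExpansion al be c ↔ (∀ ga : Ptn, ga.1 ≠ al.1 + be.1 → c ga = 0) ∧
      schurPoly (al.1 + be.1) al.2 * schurPoly (al.1 + be.1) be.2 =
        ∑ ga : (al.1 + be.1).Partition, c ⟨al.1 + be.1, ga⟩ • schurPoly (al.1 + be.1) ga := by
  rw [IsSchurExpansion, schur_eq (Nat.le_add_right _ _), schur_eq (Nat.le_add_left _ _), ← map_mul]
  refine and_congr_right fun _ => ?_
  simp_rw [schur_eq le_rfl]
  rw [← (FaithfulSMul.algebraMap_injective (MvPolynomial (Fin (al.1 + be.1)) ℤ)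
    (FractionRing (MvPolynomial (Fin (al.1 + be.1)) ℤ))).eq_iff, map_sum]
  simp_rw [map_zsmul]

/-- The choice in `lr` is meaningful only once some expansion exists; it is provided by
`eq_sum_schurCoeff`. -/
theorem isSchurExpansion_lr (al be : Ptn) : IsSchurExpansion al be fun ga => lr ga al be := by
  refine Classical.epsilon_spec (p := IsSchurExpansion al be)
    ⟨fun ga => if h : ga.1 = al.1 + be.1 then
      schurCoeff (al.1 + be.1) ga.2
        (schurPoly (al.1 + be.1) al.2 * schurPoly (al.1 + be.1) be.2) else 0, ?_⟩
  rw [isSchurExpansion_iff]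
  refine ⟨fun ga h => dif_neg h, ?_⟩
  have h := eq_sum_schurCoeff le_rfl
    ((isSymmetric_schurPoly (N := al.1 + be.1) (Nat.le_add_right _ _) al.2).mul
      (isSymmetric_schurPoly (N := al.1 + be.1) (Nat.le_add_left _ _) be.2))
    ((isHomogeneous_schurPoly al.2).mul (isHomogeneous_schurPoly be.2))
  simpa using h

theorem lr_eq_zero {al be ga : Ptn} (h : ga.1 ≠ al.1 + be.1) : lr ga al be = 0 :=
  ((isSchurExpansion_iff _ _ _).1 (isSchurExpansion_lr al be)).1 ga h

end SchurPolynomials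

end TypeI

end

noncomputable section

namespace TypeI

open Finset MvPolynomial

/-! ### Littlewood-Richardson coefficients -/

section LittlewoodRichardson

variable {N : ℕ}

/-- Setting the last variable to zero. -/
def dropLast (N : ℕ) : MvPolynomial (Fin (N + 1)) ℤ →ₐ[ℤ] MvPolynomial (Fin N) ℤ :=
  aeval (Fin.snoc (α := fun _ => MvPolynomial (Fin N) ℤ) X 0)

/-- After the substitution the last row is $(0,\dots,0,1)$, because only the last exponent is zero.
In the remaining minor every exponent exceeds that of `e'` by one, so row `i` releases a factor `X
i`. -/
theorem dropLast_altDet {e : Fin (N + 1) → ℕ} {e' : Fin N → ℕ} (h0 : e (Fin.last N) = 0)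
    (he : ∀ j : Fin N, e j.castSucc = e' j + 1) :
    dropLast N (altDet ℤ e) = (∏ i, X i) * altDet ℤ e' := by
  have h1 : dropLast N (altDet ℤ e) = (Matrix.of fun i j : Fin (N + 1) =>
      (Fin.snoc (α := fun _ => MvPolynomial (Fin N) ℤ) X 0 i) ^ e j).det := by
    rw [altDet, ← AlgHom.coe_toRingHom, RingHom.map_det]
    congr 1
    ext1 i j
    simp [dropLast]
  rw [h1, Matrix.det_succ_row _ (Fin.last N), sum_eq_single_of_mem (Fin.last N) (mem_univ _)]
  · have h2 : ((Matrix.of fun i j : Fin (N + 1) =>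
        (Fin.snoc (α := fun _ => MvPolynomial (Fin N) ℤ) X 0 i) ^ e j).submatrix
          (Fin.last N).succAbove (Fin.last N).succAbove) =
        Matrix.of fun i j : Fin N =>
          (X i : MvPolynomial (Fin N) ℤ) * (Matrix.of fun i j : Fin N => X i ^ e' j) i j := by
      ext1 i j
      simp [he, pow_succ']
    rw [h2, Matrix.det_mul_column, Matrix.of_apply, h0, pow_zero, mul_one, ← two_mul, pow_mul]
    simp [altDet]
  · intro j _ hj
    obtain ⟨j, rfl⟩ := Fin.exists_castSucc_eq.2 hj
    simp [he]

theorem dropLast_altDet_stair : dropLast N (altDet ℤ (stair (N + 1))) =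
    (∏ i, X i) * altDet ℤ (stair N) := by
  refine dropLast_altDet (by simp [stair_apply]) fun j => ?_
  have := j.2
  simp only [stair_apply, Fin.val_castSucc]
  omega

theorem dropLast_altDet_expo {d : ℕ} (hN : d ≤ N) (lam : d.Partition) :
    dropLast N (altDet ℤ (expo (N + 1) lam)) = (∏ i, X i) * altDet ℤ (expo N lam) := by
  refine dropLast_altDet (by simp [expo_apply, part_of_le lam hN]) fun j => ?_
  have := j.2
  simp only [expo_apply, Fin.val_castSucc]
  omega

theorem dropLast_schurPoly {d : ℕ} (hN : d ≤ N) (lam : d.Partition) :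
    dropLast N (schurPoly (N + 1) lam) = schurPoly N lam := by
  have h := congrArg (dropLast N) (altDet_stair_mul_schurPoly (N := N + 1) (by omega) lam)
  rw [map_mul, dropLast_altDet_stair, dropLast_altDet_expo hN, mul_assoc,
    ← altDet_stair_mul_schurPoly hN] at h
  have h0 : (∏ i, X i : MvPolynomial (Fin N) ℤ) ≠ 0 := prod_ne_zero_iff.2 fun i _ => X_ne_zero i
  exact mul_left_cancel₀ altDet_stair_ne_zero (mul_left_cancel₀ h0 h)

theorem schurCoeff_dropLast {d : ℕ} (hN : d ≤ N) (lam : d.Partition)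
    {F : MvPolynomial (Fin (N + 1)) ℤ} (hs : F.IsSymmetric) (hF : F.IsHomogeneous d) :
    schurCoeff N lam (dropLast N F) = schurCoeff (N + 1) lam F := by
  conv_lhs => rw [eq_sum_schurCoeff (hN.trans (Nat.le_succ N)) hs hF]
  rw [map_sum, map_sum]
  simp_rw [map_zsmul, dropLast_schurPoly hN, schurCoeff_schurPoly hN]
  simp

/-- The definition reads the coefficient in $|\alpha|+|\beta|$ variables. Stability under setting
the last variable to zero raises this number one at a time, so that all coefficients can be read in
one common polynomial ring. -/
theorem lr_eq_schurCoeff {al be ga : Ptn} (hg : ga.1 ≤ N) :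
    lr ga al be = schurCoeff N ga.2 (schurPoly N al.2 * schurPoly N be.2) := by
  obtain ⟨g, ga⟩ := ga
  by_cases h : g = al.1 + be.1
  · subst h
    simp only at hg ⊢
    induction N, hg using Nat.le_induction with
    | base =>
      have h1 := ((isSchurExpansion_iff _ _ _).1 (isSchurExpansion_lr al be)).2
      rw [h1, map_sum]
      simp_rw [map_zsmul, schurCoeff_schurPoly le_rfl]
      simp
    | succ n hn ih =>
      have ha : al.1 ≤ n := by omega
      have hb : be.1 ≤ n := by omega
      rw [ih, ← dropLast_schurPoly ha, ← dropLast_schurPoly hb, ← map_mul,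
        schurCoeff_dropLast hn]
      · exact (isSymmetric_schurPoly (by omega) _).mul (isSymmetric_schurPoly (by omega) _)
      · exact (isHomogeneous_schurPoly _).mul (isHomogeneous_schurPoly _)
  · rw [lr_eq_zero h, schurCoeff_eq_zero hg ga
      ((isHomogeneous_schurPoly al.2).mul (isHomogeneous_schurPoly be.2)) (Ne.symm h)]

theorem schurCoeff_schurPoly_ptn {lam mu : Ptn} (hl : lam.1 ≤ N) (hm : mu.1 ≤ N) :
    schurCoeff N lam.2 (schurPoly N mu.2) = if lam = mu then 1 else 0 := by
  obtain ⟨l, lam⟩ := lam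
  obtain ⟨m, mu⟩ := mu
  by_cases h : l = m
  · subst h
    simp [schurCoeff_schurPoly hl]
  · rw [schurCoeff_eq_zero hl lam (isHomogeneous_schurPoly mu) (Ne.symm h), if_neg]
    exact fun h' => h (congrArg Sigma.fst h')

theorem mem_ptnsLE {m : ℕ} {al : Ptn} : al ∈ ptnsLE m ↔ al.1 ≤ m := by
  simp [ptnsLE]

theorem isSymmetric_list_prod (L : List Ptn) (hL : ∀ be ∈ L, be.1 ≤ N) :
    (L.map fun be => schurPoly N be.2).prod.IsSymmetric := by
  induction L with
  | nil => exact fun w => map_one _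
  | cons be L ih =>
    rw [List.map_cons, List.prod_cons]
    exact (isSymmetric_schurPoly (hL be (by simp)) _).mul (ih fun b hb => hL b (by simp [hb]))

theorem isHomogeneous_list_prod (L : List Ptn) :
    (L.map fun be => schurPoly N be.2).prod.IsHomogeneous (L.map Sigma.fst).sum := by
  induction L with
  | nil => exact isHomogeneous_one _ _
  | cons be L ih =>
    simp only [List.map_cons, List.prod_cons, List.sum_cons]
    exact (isHomogeneous_schurPoly _).mul ih

/-- Expand `F` in Schur polynomials and multiply each by $s_\beta$. Only `al` of the degree of `F`
contributes, and both sides vanish when the degrees do not add up. -/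
theorem sum_lr_mul_schurCoeff {lam be : Ptn} (hl : lam.1 ≤ N)
    {F : MvPolynomial (Fin N) ℤ} {m : ℕ} (hs : F.IsSymmetric) (hF : F.IsHomogeneous m) :
    ∑ al ∈ ptnsLE lam.1, lr lam al be * schurCoeff N al.2 F =
      schurCoeff N lam.2 (schurPoly N be.2 * F) := by
  by_cases h : m + be.1 = lam.1
  · have hm : m ≤ N := by omega
    conv_rhs => rw [eq_sum_schurCoeff hm hs hF, mul_sum, map_sum]
    rw [ptnsLE, sum_sigma, sum_eq_single_of_mem m (by rw [mem_range]; omega)]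
    · refine sum_congr rfl fun al _ => ?_
      rw [lr_eq_schurCoeff (al := ⟨m, al⟩) hl, mul_smul_comm, map_zsmul, smul_eq_mul,
        mul_comm, mul_comm (schurPoly N be.2)]
    · intro k hk hkm
      refine sum_eq_zero fun al _ => ?_
      rw [schurCoeff_eq_zero (by rw [mem_range] at hk; omega) al hF (Ne.symm hkm), mul_zero]
  · rw [schurCoeff_eq_zero hl lam.2 ((isHomogeneous_schurPoly be.2).mul hF)
      (by rw [add_comm]; exact h)]
    refine sum_eq_zero fun al hal => ?_
    rw [mem_ptnsLE] at hal
    by_cases hm : m = al.1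
    · rw [lr_eq_zero (fun h' => h (by rw [hm, ← h'])), zero_mul]
    · rw [schurCoeff_eq_zero (hal.trans hl) al.2 hF hm, mul_zero]

theorem genLR_eq_schurCoeff {L : List Ptn} (hL0 : L ≠ []) (hL : ∀ be ∈ L, be.1 ≤ N) :
    ∀ {lam : Ptn}, lam.1 ≤ N →
      genLR lam L = schurCoeff N lam.2 (L.map fun be => schurPoly N be.2).prod := by
  induction L with
  | nil => exact absurd rfl hL0
  | cons b1 L ih =>
    intro lam hl
    rcases L with _ | ⟨b2, L⟩
    · rw [genLR, List.map_cons, List.map_nil, List.prod_cons, List.prod_nil, mul_one,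
        schurCoeff_schurPoly_ptn hl (hL b1 (by simp))]
    rcases L with _ | ⟨b3, L⟩
    · rw [genLR, List.map_cons, List.map_cons, List.map_nil, List.prod_cons, List.prod_cons,
        List.prod_nil, mul_one, lr_eq_schurCoeff hl]
    · have hL' : ∀ be ∈ b2 :: b3 :: L, be.1 ≤ N := fun b hb => hL b (List.mem_cons_of_mem _ hb)
      rw [genLR, List.map_cons, List.prod_cons, ← sum_lr_mul_schurCoeff hl
        (isSymmetric_list_prod _ hL') (isHomogeneous_list_prod _)]
      refine sum_congr rfl fun al hal => ?_
      rw [ih (by simp) hL' ((mem_ptnsLE.1 hal).trans hl)]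

theorem genLR_ofFn {n d : ℕ} (hn : 1 ≤ n) (lam : d.Partition) {be : Fin n → Ptn}
    (hb : ∀ i, (be i).1 ≤ d) :
    genLR ⟨d, lam⟩ (List.ofFn be) = schurCoeff d lam (∏ i, schurPoly d (be i).2) := by
  rw [genLR_eq_schurCoeff (N := d) (by rw [Ne, List.ofFn_eq_nil_iff]; omega) (by
    intro b h
    obtain ⟨i, rfl⟩ := (List.mem_ofFn' _ _).1 h
    exact hb i) le_rfl, List.map_ofFn, List.prod_ofFn]
  rfl

end LittlewoodRichardson

end TypeI

end

noncomputable section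

namespace TypeI

open Finset

/-! ### The Cauchy identity -/

section Cauchy

/-- This is Cauchy's determinant with denominators cleared. Column `j` consists of the values at the
$x_i$ of a polynomial of degree below `N` that depends only on $y$, so the matrix is a Vandermonde
matrix times some $B(y)$. The choice $x_i=y_i^{-1}$ makes the matrix diagonal and reveals $\det B$.
-/
theorem det_prod_one_sub_of_field {K : Type*} [Field K] {N : ℕ} (x y : Fin N → K)
    (hy0 : ∀ i, y i ≠ 0) (hy : Function.Injective y) :
    (Matrix.of fun i j : Fin N => ∏ k ∈ {j}ᶜ, (1 - x i * y k)).det =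
      (Matrix.vandermonde x).det * (Matrix.vandermonde y).det := by
  let P : Fin N → Polynomial K := fun j => ∏ k ∈ {j}ᶜ, (1 - Polynomial.C (y k) * Polynomial.X)
  have hPe : ∀ j a, (P j).eval a = ∏ k ∈ {j}ᶜ, (1 - a * y k) := by
    intro j a
    rw [Polynomial.eval_prod]
    refine prod_congr rfl fun k _ => ?_
    rw [Polynomial.eval_sub, Polynomial.eval_one, Polynomial.eval_mul, Polynomial.eval_C,
      Polynomial.eval_X, mul_comm]
  have hPd : ∀ j, (P j).natDegree < N := by
    intro j
    have h1 : (P j).natDegree ≤ ∑ k ∈ ({j}ᶜ : Finset (Fin N)), 1 := by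
      refine (Polynomial.natDegree_prod_le _ _).trans (sum_le_sum fun k _ => ?_)
      refine (Polynomial.natDegree_sub_le _ _).trans (max_le (by simp) ?_)
      exact (Polynomial.natDegree_C_mul_le _ _).trans Polynomial.natDegree_X_le
    rw [sum_const, card_compl, card_singleton, Fintype.card_fin, smul_eq_mul, mul_one] at h1
    have := j.2
    omega
  let B : Matrix (Fin N) (Fin N) K := Matrix.of fun k j => (P j).coeff k
  have hfac : ∀ z : Fin N → K, (Matrix.of fun i j : Fin N => ∏ k ∈ {j}ᶜ, (1 - z i * y k)) =
      Matrix.vandermonde z * B := by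
    intro z
    ext1 i j
    rw [Matrix.mul_apply, Matrix.of_apply, ← hPe, Polynomial.eval_eq_sum_range' (hPd j),
      ← Fin.sum_univ_eq_sum_range (fun k => (P j).coeff k * z i ^ k) N]
    refine sum_congr rfl fun k _ => ?_
    rw [Matrix.vandermonde_apply, mul_comm]
    rfl
  have hB : B.det = (Matrix.vandermonde y).det := by
    have h1 := congrArg Matrix.det (hfac fun i => (y i)⁻¹)
    rw [Matrix.det_mul] at h1
    have h2 : (Matrix.of fun i j : Fin N => ∏ k ∈ {j}ᶜ, (1 - (y i)⁻¹ * y k)) =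
        Matrix.diagonal fun j => ∏ k ∈ {j}ᶜ, (1 - (y j)⁻¹ * y k) := by
      ext1 i j
      rw [Matrix.of_apply]
      rcases eq_or_ne i j with rfl | hij
      · rw [Matrix.diagonal_apply_eq]
      · rw [Matrix.diagonal_apply_ne _ hij]
        refine prod_eq_zero (i := i) (by simpa using hij) ?_
        rw [inv_mul_cancel₀ (hy0 i), sub_self]
    -- The off-diagonal factors are paired: those for $(i,j)$ and $(j,i)$ multiply to
    -- $(y_j^{-1}-y_i^{-1})(y_j-y_i)$.
    rw [h2, Matrix.det_diagonal,
      ← prod_prod_Ioi_mul_eq_prod_prod_off_diag fun k j => 1 - (y j)⁻¹ * y k] at h1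
    have h3 : (Matrix.vandermonde fun i => (y i)⁻¹).det ≠ 0 :=
      Matrix.det_vandermonde_ne_zero_iff.2 fun i j h => hy (inv_injective h)
    apply mul_left_cancel₀ h3
    rw [← h1, Matrix.det_vandermonde, Matrix.det_vandermonde, ← prod_mul_distrib]
    refine prod_congr rfl fun i _ => ?_
    rw [← prod_mul_distrib]
    refine prod_congr rfl fun j _ => ?_
    have := hy0 i
    have := hy0 j
    field_simp
  rw [hfac, Matrix.det_mul, hB]

theorem det_prod_one_sub {S : Type*} [CommRing S] [IsDomain S] {N : ℕ} (x y : Fin N → S)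
    (hy0 : ∀ i, y i ≠ 0) (hy : Function.Injective y) :
    (Matrix.of fun i j : Fin N => ∏ k ∈ {j}ᶜ, (1 - x i * y k)).det =
      (Matrix.vandermonde x).det * (Matrix.vandermonde y).det := by
  have hinj := FaithfulSMul.algebraMap_injective S (FractionRing S)
  have h := det_prod_one_sub_of_field (fun i => algebraMap S (FractionRing S) (x i))
    (fun i => algebraMap S (FractionRing S) (y i)) (fun i => by simpa using hy0 i)
    (hinj.comp hy)
  apply hinj
  rw [map_mul, RingHom.map_det, RingHom.map_det, RingHom.map_det]
  have e1 : (algebraMap S (FractionRing S)).mapMatrix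
      (Matrix.of fun i j : Fin N => ∏ k ∈ {j}ᶜ, (1 - x i * y k)) =
      Matrix.of fun i j : Fin N => ∏ k ∈ {j}ᶜ,
        (1 - algebraMap S (FractionRing S) (x i) * algebraMap S (FractionRing S) (y k)) := by
    ext1 i j
    simp
  have e2 : ∀ z : Fin N → S, (algebraMap S (FractionRing S)).mapMatrix (Matrix.vandermonde z) =
      Matrix.vandermonde fun i => algebraMap S (FractionRing S) (z i) := by
    intro z
    ext1 i j
    simp [Matrix.vandermonde_apply]
  rw [e1, e2, e2]
  exact h

open PowerSeries in
/-- The geometric series `1 / (1 - a t)`. -/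
def geom {R : Type*} [CommRing R] (a : R) : PowerSeries R := PowerSeries.mk fun k => a ^ k

open PowerSeries in
theorem one_sub_mul_geom {R : Type*} [CommRing R] (a : R) : (1 - X * C a) * geom a = 1 := by
  have h := congrArg (rescale a) (mk_one_mul_one_sub_eq_one R)
  rw [map_mul, map_one, map_sub, map_one, rescale_X, rescale_mk, mul_comm, mul_comm (C a)] at h
  convert h using 2
  rw [geom]
  simp

/-- The complete homogeneous symmetric polynomial of degree `d`, evaluated at a family. -/
def complete {R ι : Type*} [CommRing R] [Fintype ι] (z : ι → R) (d : ℕ) : R :=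
  PowerSeries.coeff d (∏ i, geom (z i))

theorem complete_eq_sum {R ι : Type*} [CommRing R] [Fintype ι] [DecidableEq ι] (z : ι → R)
    (d : ℕ) : complete z d = ∑ l ∈ finsuppAntidiag univ d, ∏ i, z i ^ l i := by
  rw [complete, PowerSeries.coeff_prod]
  simp [geom]

theorem map_complete {R S ι : Type*} [CommRing R] [CommRing S] [Fintype ι] (φ : R →+* S)
    (z : ι → R) (d : ℕ) : φ (complete z d) = complete (fun i => φ (z i)) d := by
  classical
  rw [complete_eq_sum, complete_eq_sum, map_sum]
  simp

theorem complete_comp_equiv {R ι κ : Type*} [CommRing R] [Fintype ι] [Fintype κ] (e : ι ≃ κ)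
    (z : κ → R) (d : ℕ) : complete (fun i => z (e i)) d = complete z d := by
  rw [complete, complete, Equiv.prod_comp e fun i => geom (z i)]

/-- Pulling $\prod_k 1/(1-x_iy_kt)$ out of row `i` leaves the matrix of `det_prod_one_sub` for the
families $tx_i$ and $y_k$; the power of $t$ comes from the Vandermonde determinant of the $tx_i$. -/
theorem det_geom {R : Type*} [CommRing R] [IsDomain R] {N : ℕ} (x y : Fin N → R)
    (hy0 : ∀ i, y i ≠ 0) (hy : Function.Injective y) :
    (Matrix.of fun i j : Fin N => geom (x i * y j)).det =
      PowerSeries.X ^ (∑ i, stair N i) *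
        PowerSeries.C ((Matrix.vandermonde x).det * (Matrix.vandermonde y).det) *
        ∏ p : Fin N × Fin N, geom (x p.1 * y p.2) := by
  have h1 : (Matrix.of fun i j : Fin N => geom (x i * y j)) = Matrix.of fun i j : Fin N =>
      (∏ k, geom (x i * y k)) * (Matrix.of fun i j : Fin N =>
        ∏ k ∈ {j}ᶜ, (1 - PowerSeries.X * PowerSeries.C (x i) * PowerSeries.C (y k))) i j := by
    ext1 i j
    simp only [Matrix.of_apply]
    rw [← mul_prod_erase univ _ (mem_univ j), mul_assoc, ← compl_singleton, ← prod_mul_distrib,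
      prod_eq_one, mul_one]
    intro k _
    rw [mul_comm, mul_assoc, ← map_mul, one_sub_mul_geom]
  have hC : Function.Injective (PowerSeries.C (R := R)) := PowerSeries.C_injective
  rw [h1, Matrix.det_mul_column, det_prod_one_sub _ (fun k => PowerSeries.C (y k))
    (fun i => by rw [Ne, map_eq_zero_iff _ hC]; exact hy0 i) (hC.comp hy),
    Fintype.prod_prod_type, mul_comm, map_mul, ← mul_assoc]
  congr 2
  · have h2 : (Matrix.vandermonde fun i => PowerSeries.X * PowerSeries.C (x i)) =
        Matrix.of fun i j : Fin N => (PowerSeries.X : PowerSeries R) ^ (j : ℕ) *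
          (PowerSeries.C.mapMatrix (Matrix.vandermonde x)) i j := by
      ext1 i j
      simp [Matrix.vandermonde_apply, mul_pow]
    rw [h2, Matrix.det_mul_row, prod_pow_eq_pow_sum, RingHom.map_det]
    congr 2
    refine Fintype.sum_equiv Fin.revPerm _ _ fun i => ?_
    rw [stair_apply, Fin.revPerm_apply, Fin.val_rev]
    have := i.2
    omega
  · rw [RingHom.map_det]
    congr 1
    ext1 i j
    simp [Matrix.vandermonde_apply]

open MvPolynomial

variable {N : ℕ}

/-- Polynomials in two families of `N` variables. -/
abbrev Poly₂ (N : ℕ) : Type := MvPolynomial (Fin N) (MvPolynomial (Fin N) ℤ)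

/-- A polynomial in the first family of variables. -/
abbrev inl₂ (N : ℕ) : MvPolynomial (Fin N) ℤ →+* Poly₂ N := C

/-- A polynomial in the second family of variables. -/
abbrev inr₂ (N : ℕ) : MvPolynomial (Fin N) ℤ →+* Poly₂ N := MvPolynomial.map C

theorem inr₂_altDet (e : Fin N → ℕ) : inr₂ N (altDet ℤ e) = altDet _ e := by
  rw [altDet, altDet, RingHom.map_det]
  congr 1
  ext1 i j
  simp

/-- Each alternant has decreasing exponents and differs from the Vandermonde determinant by the sign
of the reversal; the two signs cancel. -/
theorem inl₂_stair_mul_altDet_stair :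
    inl₂ N (altDet ℤ (stair N)) * altDet _ (stair N) =
      (Matrix.vandermonde fun i => inl₂ N (X i)).det *
        (Matrix.vandermonde fun i => (X i : Poly₂ N)).det := by
  have h : ∀ {S : Type} [CommRing S] (z : Fin N → S),
      (Matrix.of fun i j : Fin N => z i ^ ((Fin.rev j : Fin N) : ℕ)).det =
        ((Equiv.Perm.sign (Fin.revPerm (n := N)) : ℤ) : S) * (Matrix.vandermonde z).det := by
    intro S _ z
    rw [← Matrix.det_permute']
    rfl
  have h1 : inl₂ N (altDet ℤ (stair N)) =
      (Matrix.of fun i j : Fin N => inl₂ N (X i) ^ ((Fin.rev j : Fin N) : ℕ)).det := by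
    rw [altDet_stair_eq, RingHom.map_det]
    congr 1
    ext1 i j
    simp
  rw [h1, altDet_stair_eq, h, h]
  rcases Int.units_eq_one_or (Equiv.Perm.sign (Fin.revPerm (n := N))) with h | h <;>
  · rw [h]
    push_cast
    ring

theorem isSymmetric_complete (d : ℕ) :
    (complete (fun p : Fin N × Fin N => inl₂ N (X p.1) * X p.2) d).IsSymmetric := by
  intro w
  rw [← AlgHom.coe_toRingHom, map_complete]
  simp only [map_mul, AlgHom.coe_toRingHom, rename_C, rename_X]
  exact complete_comp_equiv ((Equiv.refl _).prodCongr w)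
    (fun p : Fin N × Fin N => inl₂ N (X p.1) * X p.2) d

theorem isHomogeneous_complete (d : ℕ) :
    (complete (fun p : Fin N × Fin N => inl₂ N (X p.1) * X p.2) d).IsHomogeneous d := by
  rw [complete_eq_sum]
  refine IsHomogeneous.sum _ _ _ fun l hl => ?_
  rw [mem_finsuppAntidiag] at hl
  rw [← hl.1]
  refine IsHomogeneous.prod _ _ _ fun p _ => ?_
  rw [mul_pow, ← map_pow]
  exact (isHomogeneous_X_pow _ _).C_mul _

/-- Compare coefficients of $t^{d+|\delta|}$ in `det_geom`, where $\delta$ is the staircase.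
Expanding the determinant of geometric series column by column gives the alternants $a_l(x)$ with
the monomials $y^l$. -/
theorem stair_mul_complete (d : ℕ) :
    inl₂ N (altDet ℤ (stair N)) * altDet _ (stair N) *
        complete (fun p : Fin N × Fin N => inl₂ N (X p.1) * X p.2) d =
      ∑ l ∈ finsuppAntidiag univ (d + ∑ i, stair N i), inl₂ N (altDet ℤ l) * monomial l 1 := by
  have h := congrArg (PowerSeries.coeff (d + ∑ i, stair N i))
    (det_geom (fun i => inl₂ N (X i)) (fun i => (X i : Poly₂ N)) (fun i => X_ne_zero i)
      (X_injective))
  rw [← inl₂_stair_mul_altDet_stair, mul_assoc, PowerSeries.coeff_X_pow_mul,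
    PowerSeries.coeff_C_mul] at h
  rw [complete, ← h, Matrix.det_apply, map_sum]
  have h1 : ∀ l : Fin N →₀ ℕ, inl₂ N (altDet ℤ l) * monomial l 1 =
      ∑ w : Equiv.Perm (Fin N), Equiv.Perm.sign w •
        ∏ i, (inl₂ N (X (w i)) * X i) ^ l i := by
    intro l
    rw [altDet, Matrix.det_apply, map_sum, sum_mul]
    refine sum_congr rfl fun w _ => ?_
    simp_rw [mul_pow, prod_mul_distrib]
    rw [prod_X_pow, Units.smul_def, Units.smul_def, map_zsmul, smul_mul_assoc, map_prod]
    simp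
  simp_rw [h1]
  rw [sum_comm]
  refine sum_congr rfl fun w _ => ?_
  rw [← smul_sum, Units.smul_def, Units.smul_def, map_zsmul, PowerSeries.coeff_prod]
  simp [geom]

/-- The Cauchy identity in degree `d`. -/
theorem sum_schurPoly_mul_schurPoly {d : ℕ} (hN : d ≤ N) :
    ∑ lam : d.Partition, inl₂ N (schurPoly N lam) * inr₂ N (schurPoly N lam) =
      complete (fun p : Fin N × Fin N => inl₂ N (X p.1) * X p.2) d := by
  set h := complete (fun p : Fin N × Fin N => inl₂ N (X p.1) * X p.2) d with hh
  set F := inl₂ N (altDet ℤ (stair N)) * altDet _ (stair N) * h with hF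
  have halt : IsAlt F := by
    rw [hF, mul_assoc]
    exact ((isAlt_altDet _).mul_symmetric (isSymmetric_complete d)).C_mul _
  have hhom : F.IsHomogeneous (d + ∑ i, stair N i) := by
    rw [hF, mul_assoc, add_comm d]
    exact ((isHomogeneous_altDet _).mul (isHomogeneous_complete d)).C_mul _
  -- `F` is alternating in $y$, hence determined by its coefficients at the exponents
  -- $\lambda+\delta$, and a single `l` contributes to each.
  have hco : ∀ lam : d.Partition, coeff (expo N lam) F = altDet ℤ (expo N lam) := by
    intro lam
    rw [hF, hh, stair_mul_complete, coeff_sum, sum_eq_single_of_mem (expo N lam)]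
    · rw [coeff_C_mul, coeff_monomial, if_pos rfl, mul_one]
    · rw [mem_finsuppAntidiag]
      exact ⟨sum_expo lam hN, by simp⟩
    · intro l _ hl
      rw [coeff_C_mul, coeff_monomial, if_neg hl, mul_zero]
  have key := halt.eq_sum hN hhom
  simp_rw [hco] at key
  have h0 : inl₂ N (altDet ℤ (stair N)) * altDet _ (stair N) ≠ 0 :=
    mul_ne_zero (by rw [Ne, C_eq_zero]; exact altDet_stair_ne_zero) altDet_stair_ne_zero
  apply mul_left_cancel₀ h0
  rw [← hF, key, mul_sum]
  refine sum_congr rfl fun lam _ => ?_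
  rw [← inr₂_altDet, ← inr₂_altDet, ← altDet_stair_mul_schurPoly hN lam, map_mul, map_mul]
  ring

end Cauchy

end TypeI

end

noncomputable section

namespace TypeI

open Finset

/-! ### Colourings fixed by a permutation -/

section Burnside

variable {R ι κ : Type*} [CommRing R] [Fintype ι] [Fintype κ] {d : ℕ}

open scoped Classical in
/-- The sum of the monomials `∏ z (f j)` over the colourings `f` that are fixed by `g`, which is
the product of the power sums of `z` with exponents the cycle lengths of `g`. -/
def fixSum (g : Equiv.Perm (Fin d)) (z : ι → R) : R :=
  ∑ f : Fin d → ι with ∀ i, f (g i) = f i, ∏ j, z (f j)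

theorem map_fixSum {S : Type*} [CommRing S] (φ : R →+* S) (g : Equiv.Perm (Fin d)) (z : ι → R) :
    φ (fixSum g z) = fixSum g fun i => φ (z i) := by
  simp [fixSum, map_sum, map_prod]

/-- A fixed colouring by pairs is a pair of fixed colourings. -/
theorem fixSum_mul (g : Equiv.Perm (Fin d)) (z : ι → R) (y : κ → R) :
    fixSum g (fun p : ι × κ => z p.1 * y p.2) = fixSum g z * fixSum g y := by
  classical
  rw [fixSum, fixSum, fixSum, sum_mul_sum, ← sum_product']
  refine sum_nbij' (fun f => (fun i => (f i).1, fun i => (f i).2)) (fun p i => (p.1 i, p.2 i))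
    ?_ ?_ ?_ ?_ ?_
  · intro f hf
    simp only [mem_filter, mem_univ, true_and, mem_product] at hf ⊢
    exact ⟨fun i => by rw [hf], fun i => by rw [hf]⟩
  · intro p hp
    simp only [mem_filter, mem_univ, true_and, mem_product] at hp ⊢
    exact fun i => by rw [hp.1, hp.2]
  · intro f _; rfl
  · intro p _; rfl
  · intro f _; rw [prod_mul_distrib]

/-- The orbit of a colouring, weighted by the orders of the stabilizers. -/
theorem sum_card_stab (f₀ : Fin d → ι) [DecidableEq ι] :
    ∑ f : Fin d → ι with ∀ x, #{i | f i = x} = #{i | f₀ i = x},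
      #{g : Equiv.Perm (Fin d) | ∀ i, f (g i) = f i} = Fintype.card (Equiv.Perm (Fin d)) := by
  classical
  -- The permutations `h` are sorted by the colouring `f₀ ∘ h`; the fibre over `f` is a left coset
  -- of the stabilizer of `f`.
  rw [← card_univ, card_eq_sum_card_fiberwise
    (f := fun h : Equiv.Perm (Fin d) => fun i => f₀ (h i))
    (t := {f : Fin d → ι | ∀ x, #{i | f i = x} = #{i | f₀ i = x}})]
  · refine sum_congr rfl fun f hf => ?_
    simp only [mem_filter, mem_univ, true_and] at hf
    obtain ⟨h₀, hh⟩ := exists_perm_comp_eq f₀ f fun x => (hf x).symm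
    refine card_nbij' (fun g => h₀ * g) (fun h => h₀⁻¹ * h) ?_ ?_ ?_ ?_
    · intro g hg
      simp only [coe_filter, mem_univ, true_and, Set.mem_ofPred_eq] at hg ⊢
      funext i
      rw [Equiv.Perm.mul_apply, hh, hg]
    · intro h hg
      simp only [coe_filter, mem_univ, true_and, Set.mem_ofPred_eq] at hg ⊢
      intro i
      have h1 : f ((h₀⁻¹ * h) i) = f₀ (h i) := by rw [← hh]; simp
      rw [h1]
      exact congrFun hg i
    · intro g _; simp
    · intro g _; simp
  · intro h _
    simp only [coe_filter, mem_univ, true_and, Set.mem_ofPred_eq]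
    intro x
    exact card_bij (fun i _ => h i) (by simp) (by simp)
      fun b hb => ⟨h.symm b, by simpa using hb, by simp⟩

theorem exists_content_eq [DecidableEq ι] (l : ι → ℕ) (hl : ∑ i, l i = d) :
    ∃ f : Fin d → ι, ∀ x, #{i | f i = x} = l x := by
  have e : Fin d ≃ Σ i, Fin (l i) := Fintype.equivOfCardEq (by simp [hl])
  refine ⟨fun i => (e i).1, fun x => ?_⟩
  have h : #{i | (e i).1 = x} = #{p : Σ i, Fin (l i) | p.1 = x} :=
    card_bij (fun i _ => e i) (by simp) (by simp) fun b hb => ⟨e.symm b, by simpa using hb, by simp⟩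
  rw [h, ← Fintype.card_fin (l x), ← card_univ]
  refine (card_bij (fun j _ => (⟨x, j⟩ : Σ i, Fin (l i))) (by simp) (by simp) ?_).symm
  rintro ⟨y, j⟩ hb
  simp only [mem_filter, mem_univ, true_and] at hb
  subst hb
  exact ⟨j, mem_univ _, rfl⟩

theorem prod_comp_eq_prod_pow [DecidableEq ι] (z : ι → R) (f : Fin d → ι) :
    ∏ j, z (f j) = ∏ i, z i ^ #{j | f j = i} := by
  rw [← prod_fiberwise_of_maps_to (s := univ) (t := univ) (g := f) (fun _ _ => mem_univ _)]
  refine prod_congr rfl fun i _ => ?_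
  rw [prod_congr rfl fun j hj => by rw [(mem_filter.1 hj).2], prod_const]

/-- The cycle index of the symmetric group. -/
theorem sum_fixSum (z : ι → R) :
    ∑ g : Equiv.Perm (Fin d), fixSum g z = Fintype.card (Equiv.Perm (Fin d)) * complete z d := by
  classical
  have h1 : ∑ g : Equiv.Perm (Fin d), fixSum g z = ∑ f : Fin d → ι,
      (#{g : Equiv.Perm (Fin d) | ∀ i, f (g i) = f i} : R) * ∏ j, z (f j) := by
    simp_rw [fixSum, sum_filter]
    rw [sum_comm]
    refine sum_congr rfl fun f _ => ?_
    rw [← sum_filter, sum_const, nsmul_eq_mul]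
  let ct : (Fin d → ι) → ι →₀ ℕ := fun f => Finsupp.equivFunOnFinite.symm fun i => #{j | f j = i}
  have hct : ∀ f i, ct f i = #{j | f j = i} := fun f i => rfl
  -- Colourings are grouped by content: those of content `l` share one monomial and form one orbit,
  -- whose stabilizer orders add up to $d!$.
  rw [h1, complete_eq_sum, mul_sum, ← sum_fiberwise_of_maps_to (g := ct)
    (t := finsuppAntidiag univ d)]
  · refine sum_congr rfl fun l hl => ?_
    rw [mem_finsuppAntidiag] at hl
    obtain ⟨f₀, hf₀⟩ := exists_content_eq l hl.1
    rw [← sum_card_stab f₀, Nat.cast_sum, sum_mul]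
    refine sum_congr ?_ fun f hf => ?_
    · ext f
      simp only [mem_filter, mem_univ, true_and, DFunLike.ext_iff, hct, hf₀]
    · simp only [mem_filter, mem_univ, true_and, hf₀] at hf
      rw [prod_comp_eq_prod_pow]
      simp_rw [hf]
  · intro f _
    rw [mem_finsuppAntidiag]
    refine ⟨?_, by simp⟩
    change ∑ i, #{j | f j = i} = d
    exact (card_eq_sum_card_fiberwise (f := f) (s := univ) (t := univ)
      (fun _ _ => mem_univ _)).symm.trans (by simp)

/-! ### Fixed colourings and cycles. -/

theorem apply_eq_of_sameCycle {α : Type*} {g : Equiv.Perm (Fin d)} {f : Fin d → α}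
    (hf : ∀ i, f (g i) = f i) {x y : Fin d} (h : g.SameCycle x y) : f x = f y := by
  obtain ⟨n, hn, rfl⟩ := h.exists_pow_eq'
  clear hn h
  induction n with
  | zero => rfl
  | succ n ih => rw [ih, pow_succ', Equiv.Perm.mul_apply, hf]

/-- The cycle of `x`, the fixed points being kept apart. -/
def cycleLabel (g : Equiv.Perm (Fin d)) (x : Fin d) : Equiv.Perm (Fin d) ⊕ Fin d :=
  if g x = x then Sum.inr x else Sum.inl (g.cycleOf x)

theorem cycleLabel_apply (g : Equiv.Perm (Fin d)) (x : Fin d) :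
    cycleLabel g (g x) = cycleLabel g x := by
  unfold cycleLabel
  by_cases h : g x = x
  · simp [h]
  · rw [if_neg h, if_neg (fun h' => h (g.injective h')), Equiv.Perm.cycleOf_self_apply]

/-- All fixed points have trivial `cycleOf`; the second summand of the label is what separates them.
-/
theorem sameCycle_of_cycleLabel_eq {g : Equiv.Perm (Fin d)} {x y : Fin d}
    (h : cycleLabel g x = cycleLabel g y) : g.SameCycle x y := by
  unfold cycleLabel at h
  split_ifs at h with hx hy hy
  · rw [Sum.inr.inj h]
  · have h' := Sum.inl.inj h
    exact (Equiv.Perm.sameCycle_iff_cycleOf_eq_of_mem_support (Equiv.Perm.mem_support.2 hx)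
      (Equiv.Perm.mem_support.2 hy)).2 h'

theorem image_cycleLabel (g : Equiv.Perm (Fin d)) :
    univ.image (cycleLabel g) = g.cycleFactorsFinset.disjSum g.supportᶜ := by
  ext u
  rw [mem_image, mem_disjSum]
  constructor
  · rintro ⟨x, _, rfl⟩
    unfold cycleLabel
    split_ifs with h
    · exact Or.inr ⟨x, by simpa using h, rfl⟩
    · exact Or.inl ⟨_, Equiv.Perm.cycleOf_mem_cycleFactorsFinset_iff.2
        (Equiv.Perm.mem_support.2 h), rfl⟩
  · rintro (⟨c, hc, rfl⟩ | ⟨x, hx, rfl⟩)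
    · obtain ⟨x, hx⟩ := (Equiv.Perm.mem_cycleFactorsFinset_iff.1 hc).1.nonempty_support
      refine ⟨x, mem_univ _, ?_⟩
      have hgx : g x ≠ x := Equiv.Perm.mem_support.1
        (Equiv.Perm.mem_cycleFactorsFinset_support_le hc hx)
      rw [cycleLabel, if_neg hgx, ← Equiv.Perm.cycle_is_cycleOf hx hc]
    · refine ⟨x, mem_univ _, ?_⟩
      rw [cycleLabel, if_pos (by simpa using hx)]

theorem card_image_cycleLabel (g : Equiv.Perm (Fin d)) :
    #(univ.image (cycleLabel g)) = numCycles g := by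
  rw [image_cycleLabel, card_disjSum, numCycles, Equiv.Perm.parts_partition, Multiset.card_add,
    Multiset.card_replicate, card_compl, Equiv.Perm.cycleType_def, Multiset.card_map]
  rfl

/-- The number of colourings fixed by a permutation. -/
theorem fixSum_one (g : Equiv.Perm (Fin d)) :
    fixSum g (fun _ : κ => (1 : R)) = (Fintype.card κ : R) ^ numCycles g := by
  classical
  simp only [fixSum, prod_const_one, sum_const, nsmul_eq_mul, mul_one]
  rw [← Nat.cast_pow]
  congr 1
  rw [← card_image_cycleLabel, ← Fintype.card_coe (univ.image (cycleLabel g)), ← Fintype.card_fun,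
    ← card_univ]
  have hmem : ∀ x, cycleLabel g x ∈ univ.image (cycleLabel g) := fun x =>
    mem_image_of_mem _ (mem_univ x)
  symm
  -- A colouring is fixed exactly when it factors through the cycle labels.
  refine card_bij (fun u _ x => u ⟨cycleLabel g x, hmem x⟩) ?_ ?_ ?_
  · intro u _
    simp only [mem_filter, mem_univ, true_and]
    intro x
    simp only [cycleLabel_apply]
  · intro u _ v _ huv
    funext ⟨t, ht⟩
    obtain ⟨x, _, rfl⟩ := mem_image.1 ht
    exact congrFun huv x
  · intro f hf
    simp only [mem_filter, mem_univ, true_and] at hf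
    have hx : ∀ t : univ.image (cycleLabel g), ∃ x, cycleLabel g x = t := fun t => by
      obtain ⟨x, _, h⟩ := mem_image.1 t.2
      exact ⟨x, h⟩
    refine ⟨fun t => f (hx t).choose, mem_univ _, funext fun x => ?_⟩
    exact apply_eq_of_sameCycle hf (sameCycle_of_cycleLabel_eq (hx ⟨_, hmem x⟩).choose_spec)

end Burnside

end TypeI

end

noncomputable section

namespace TypeI

open Finset MvPolynomial

/-! ### Coefficients in two families of variables -/

section TwoFamilies

variable {d : ℕ}

/-- The coefficient of `s_λ(x) s_μ(y)`. -/
def schurCoeff₂ (lam mu : d.Partition) : Poly₂ d →+ ℤ :=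
  (schurCoeff d lam).toAddMonoidHom.comp
    ((coeffAddMonoidHom (expo d mu)).comp (AddMonoidHom.mulLeft (altDet _ (stair d))))

theorem schurCoeff₂_apply (lam mu : d.Partition) (G : Poly₂ d) :
    schurCoeff₂ lam mu G =
      schurCoeff d lam (coeff (expo d mu) (altDet (MvPolynomial (Fin d) ℤ) (stair d) * G)) := rfl

theorem schurCoeff₂_mul (lam mu : d.Partition) (F G : MvPolynomial (Fin d) ℤ) :
    schurCoeff₂ lam mu (inl₂ d F * inr₂ d G) = schurCoeff d lam F * schurCoeff d mu G := by
  have h : coeff (expo d mu) (altDet (MvPolynomial (Fin d) ℤ) (stair d) *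
      (inl₂ d F * inr₂ d G)) = schurCoeff d mu G • F := by
    rw [← inr₂_altDet, mul_left_comm, ← map_mul, coeff_C_mul, coeff_map, mul_comm,
      ← smul_eq_C_mul, schurCoeff_apply]
  rw [schurCoeff₂_apply, h, map_zsmul, smul_eq_mul, mul_comm]

/-- The coefficient of `s_λ` in the product of power sums attached to `g`. -/
def omega (lam : d.Partition) (g : Equiv.Perm (Fin d)) : ℤ := schurCoeff d lam (fixSum g X)

theorem fixSum_pair (g : Equiv.Perm (Fin d)) :
    fixSum g (fun p : Fin d × Fin d => inl₂ d (X p.1) * X p.2) =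
      inl₂ d (fixSum g X) * inr₂ d (fixSum g X) := by
  rw [fixSum_mul g (fun i => inl₂ d (X i)) (fun i => (X i : Poly₂ d)), map_fixSum, map_fixSum]
  simp

theorem schurCoeff₂_fixSum (lam mu : d.Partition) (g : Equiv.Perm (Fin d)) :
    schurCoeff₂ lam mu (fixSum g fun p : Fin d × Fin d => inl₂ d (X p.1) * X p.2) =
      omega lam g * omega mu g := by
  rw [fixSum_pair, schurCoeff₂_mul]
  rfl

/-- The cycle index of the alphabet $x_iy_j$ is $d!\,h_d$, which the Cauchy identity writes as
$d!\sum_\nu s_\nu(x)s_\nu(y)$. -/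
theorem sum_omega_mul_omega (lam mu : d.Partition) :
    ∑ g, omega lam g * omega mu g =
      if lam = mu then (Fintype.card (Equiv.Perm (Fin d)) : ℤ) else 0 := by
  simp_rw [← schurCoeff₂_fixSum]
  rw [← map_sum, sum_fixSum, ← sum_schurPoly_mul_schurPoly le_rfl, ← nsmul_eq_mul, map_nsmul,
    map_sum]
  simp_rw [schurCoeff₂_mul, schurCoeff_schurPoly le_rfl]
  simp

/-- The truncated Schur series agrees with the Cauchy product modulo $t^{d+1}$, hence so do their
`n`-th powers. The factor `1` in the alphabet displays the `n` copies as a product family, the form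
that `fixSum_mul` needs. -/
theorem coeff_pow_schur_series (n : ℕ) :
    PowerSeries.coeff d ((∑ be ∈ ptnsLE d,
      PowerSeries.C (inl₂ d (schurPoly d be.2) * inr₂ d (schurPoly d be.2)) *
        PowerSeries.X ^ be.1) ^ n) =
      complete (fun p : (Fin d × Fin d) × Fin n => inl₂ d (X p.1.1) * X p.1.2 * 1) d := by
  set T : PowerSeries (Poly₂ d) := ∑ be ∈ ptnsLE d,
      PowerSeries.C (inl₂ d (schurPoly d be.2) * inr₂ d (schurPoly d be.2)) *
        PowerSeries.X ^ be.1 with hT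
  set U : PowerSeries (Poly₂ d) := ∏ p : Fin d × Fin d, geom (inl₂ d (X p.1) * X p.2) with hU
  have hTU : PowerSeries.X ^ (d + 1) ∣ T - U := by
    rw [PowerSeries.X_pow_dvd_iff]
    intro k hk
    rw [map_sub, sub_eq_zero, hT, map_sum, ptnsLE, sum_sigma]
    simp_rw [PowerSeries.coeff_C_mul_X_pow]
    rw [sum_eq_single_of_mem k (mem_range.2 hk)]
    · simp only [if_true]
      exact sum_schurPoly_mul_schurPoly (Nat.lt_succ_iff.1 hk)
    · intro m _ hm
      exact sum_eq_zero fun be _ => if_neg (Ne.symm hm)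
  have h := PowerSeries.X_pow_dvd_iff.1 (hTU.trans (sub_dvd_pow_sub_pow T U n)) d
    (Nat.lt_succ_self d)
  rw [map_sub, sub_eq_zero] at h
  rw [h, complete, Fintype.prod_prod_type, hU]
  simp [prod_pow]

/-- The `n`-th power is expanded over `n`-tuples of partitions. Tuples of total size other than `d`
do not reach the coefficient of degree `d`, and their term in `A` vanishes as well. -/
theorem A_apply {n : ℕ} (hn : 1 ≤ n) (lam mu : d.Partition) :
    A n d lam mu = schurCoeff₂ lam mu
      (complete (fun p : (Fin d × Fin d) × Fin n => inl₂ d (X p.1.1) * X p.1.2 * 1) d) := by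
  rw [← coeff_pow_schur_series n, ← Fintype.card_fin n, ← card_univ, ← prod_const,
    prod_univ_sum, map_sum, map_sum, A, Matrix.of_apply, card_univ, Fintype.card_fin]
  refine sum_congr rfl fun be hbe => ?_
  have hb : ∀ i, (be i).1 ≤ d := fun i => mem_ptnsLE.1 (Fintype.mem_piFinset.1 hbe i)
  rw [genLR_ofFn hn lam hb, genLR_ofFn hn mu hb, prod_mul_distrib, prod_pow_eq_pow_sum, ← map_prod,
    PowerSeries.coeff_C_mul_X_pow, prod_mul_distrib, ← map_prod, ← map_prod]
  split_ifs with h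
  · rw [schurCoeff₂_mul]
  · rw [map_zero, schurCoeff_eq_zero le_rfl lam (m := ∑ i, (be i).1)
      (IsHomogeneous.prod _ _ _ fun i _ => isHomogeneous_schurPoly _) (Ne.symm h), zero_mul]

/-- The entries of `A^n_d` in terms of the class functions `omega`. -/
theorem card_mul_A {n : ℕ} (hn : 1 ≤ n) (lam mu : d.Partition) :
    (Fintype.card (Equiv.Perm (Fin d)) : ℤ) * A n d lam mu =
      ∑ g, (n : ℤ) ^ numCycles g * (omega lam g * omega mu g) := by
  rw [A_apply hn, ← nsmul_eq_mul, ← map_nsmul, nsmul_eq_mul, ← sum_fixSum, map_sum]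
  refine sum_congr rfl fun g _ => ?_
  rw [fixSum_mul g (fun p : Fin d × Fin d => inl₂ d (X p.1) * X p.2) (fun _ : Fin n => (1 : Poly₂ d)),
    fixSum_one, Fintype.card_fin, mul_comm, ← Nat.cast_pow, ← nsmul_eq_mul, map_nsmul,
    schurCoeff₂_fixSum, nsmul_eq_mul, Nat.cast_pow]

end TwoFamilies

/-! ### The Frobenius character formula -/

section Frobenius

variable {d : ℕ}

theorem Dominated.trans {lam mu nu : d.Partition} (h : Dominated lam mu) (h' : Dominated mu nu) :
    Dominated lam nu := fun k => (h k).trans (h' k)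

/-- A unitriangular orthogonal matrix is the identity. -/
theorem eq_one_of_unitriangular {V : Matrix d.Partition d.Partition ℂ}
    (h0 : ∀ lam mu, ¬ Dominated lam mu → V lam mu = 0) (h1 : ∀ lam, V lam lam = 1)
    (hV : V * V.transpose = 1) : V = 1 := by
  -- The induction descends from the most dominant partitions: when `mu` strictly dominates `lam`,
  -- row `mu` is already a unit vector, so orthogonality of rows `lam` and `mu` says that the entry
  -- at `(lam, mu)` is zero.
  let r : d.Partition → d.Partition → Prop := fun mu lam => Dominated lam mu ∧ lam ≠ mu
  have : IsTrans d.Partition r := ⟨fun a b c hab hbc => ⟨hbc.1.trans hab.1, fun h => by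
    subst h
    exact hab.2 (hab.1.antisymm hbc.1)⟩⟩
  have : Std.Irrefl r := ⟨fun a h => h.2 rfl⟩
  have hwf : WellFounded r := Finite.wellFounded_of_trans_of_irrefl r
  have key : ∀ lam, ∀ mu, V lam mu = (1 : Matrix d.Partition d.Partition ℂ) lam mu := by
    intro lam
    induction lam using hwf.induction with
    | _ lam ih =>
      intro mu
      by_cases hlm : lam = mu
      · subst hlm
        rw [h1, Matrix.one_apply_eq]
      rw [Matrix.one_apply_ne hlm]
      by_cases hd : Dominated lam mu
      · have h2 := congrFun (congrFun hV lam) mu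
        rw [Matrix.mul_apply, Matrix.one_apply_ne hlm] at h2
        simp_rw [Matrix.transpose_apply, ih mu ⟨hd, hlm⟩, Matrix.one_apply] at h2
        simpa using h2
      · exact h0 _ _ hd
  ext lam mu
  exact key lam mu

/-- The coefficient of `s_λ` in the monomial of a colouring. -/
def schurMonomial (lam : d.Partition) (f : Fin d → Fin d) : ℤ := schurCoeff d lam (∏ j, X (f j))

theorem schurMonomial_eq (lam : d.Partition) (f : Fin d → Fin d) :
    schurMonomial lam f = coeff (expo d lam) (altDet ℤ (stair d) *
      monomial (Finsupp.equivFunOnFinite.symm fun i => #{j | f j = i}) 1) := by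
  rw [schurMonomial, schurCoeff_apply, prod_comp_eq_prod_pow (X : Fin d → MvPolynomial (Fin d) ℤ) f,
    ← prod_X_pow]
  rfl

/-- The coefficient of $x^{\lambda+\delta}$ in $a_\delta$ times the monomial of `f` can be nonzero
only if $\lambda+\delta$ minus the content is a rearrangement of $\delta$. -/
theorem exists_perm_of_schurMonomial_ne_zero {lam : d.Partition} {f : Fin d → Fin d}
    (h : schurMonomial lam f ≠ 0) : ∃ w : Equiv.Perm (Fin d), ∀ i,
      stair d (w i) + #{j | f j = i} = part lam i + stair d i := by
  rw [schurMonomial_eq, coeff_mul_monomial'] at h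
  split_ifs at h with hle
  · rw [mul_one, coeff_altDet] at h
    obtain ⟨w, _, hw⟩ := exists_ne_zero_of_sum_ne_zero h
    split_ifs at hw with hw'
    · refine ⟨w⁻¹, fun i => ?_⟩
      have h1 := hw' (w⁻¹ i)
      have h2 := hle i
      have h3 : w (w⁻¹ i) = i := by simp
      rw [h3, Finsupp.tsub_apply] at h1
      rw [← h1]
      exact Nat.sub_add_cancel h2
    · exact absurd rfl hw
  · exact absurd rfl h

theorem schurMonomial_eq_one {lam : d.Partition} {f : Fin d → Fin d}
    (h : ∀ i : Fin d, #{j | f j = i} = part lam i) : schurMonomial lam f = 1 := by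
  have h1 : expo d lam =
      stair d + Finsupp.equivFunOnFinite.symm fun i => #{j | f j = i} := by
    ext i
    rw [expo_apply, ← h, add_comm]
    rfl
  rw [schurMonomial_eq, h1, coeff_mul_monomial, mul_one,
    coeff_altDet_of_strictAnti strictAnti_stair strictAnti_stair, if_pos rfl]

theorem sum_range_part_eq (lam : d.Partition) (k : ℕ) :
    ∑ r ∈ range k, part lam r = ∑ i : Fin d, if (i : ℕ) < k then part lam i else 0 := by
  rw [Fin.sum_univ_eq_sum_range (fun r => if r < k then part lam r else 0) d, ← sum_filter]
  symm
  refine sum_subset (fun r hr => ?_) fun r hr hr' => part_of_le lam ?_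
  · simp only [mem_filter, mem_range] at hr ⊢
    exact hr.2
  · simp only [mem_filter, mem_range] at hr hr'
    omega

theorem card_lt_eq_sum_univ (f : Fin d → Fin d) (k : ℕ) :
    #{j | (f j : ℕ) < k} = ∑ i : Fin d, if (i : ℕ) < k then #{j | f j = i} else 0 := by
  rw [card_eq_sum_card_fiberwise (f := f) (t := univ) (fun _ _ => mem_univ _)]
  refine sum_congr rfl fun i _ => ?_
  rw [filter_filter]
  split_ifs with hi
  · congr 1
    ext j
    simp only [mem_filter, mem_univ, true_and, and_iff_right_iff_imp]
    rintro rfl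
    exact hi
  · rw [card_eq_zero, filter_eq_empty_iff]
    rintro j - ⟨h1, rfl⟩
    exact hi h1

/-- Rearrangement inequality: the first `k` entries of the staircase are its `k` largest. -/
theorem sum_stair_comp_perm_le (w : Equiv.Perm (Fin d)) (k : ℕ) :
    (∑ i : Fin d, if (i : ℕ) < k then stair d (w i) else 0) ≤
      ∑ i : Fin d, if (i : ℕ) < k then stair d i else 0 := by
  have h : Monovary (fun i : Fin d => if (i : ℕ) < k then 1 else 0) (fun i => stair d i) := by
    intro i j hij
    have hji : j < i := strictAnti_stair.lt_iff_gt.1 hij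
    have hji' : (j : ℕ) < i := hji
    change (if (i : ℕ) < k then 1 else 0) ≤ (if (j : ℕ) < k then 1 else 0)
    split_ifs <;> omega
  have := h.sum_mul_comp_perm_le_sum_mul (σ := w)
  simpa using this

theorem sum_part_le_card_lt {lam : d.Partition} {f : Fin d → Fin d}
    (h : schurMonomial lam f ≠ 0) (k : ℕ) :
    ∑ r ∈ range k, part lam r ≤ #{j | (f j : ℕ) < k} := by
  obtain ⟨w, hw⟩ := exists_perm_of_schurMonomial_ne_zero h
  rw [sum_range_part_eq, card_lt_eq_sum_univ]
  have h1 := sum_stair_comp_perm_le w k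
  have h2 : (∑ i : Fin d, if (i : ℕ) < k then stair d (w i) else 0) +
      (∑ i : Fin d, if (i : ℕ) < k then #{j | f j = i} else 0) =
      (∑ i : Fin d, if (i : ℕ) < k then part lam i else 0) +
      ∑ i : Fin d, if (i : ℕ) < k then stair d i else 0 := by
    rw [← sum_add_distrib, ← sum_add_distrib]
    refine sum_congr rfl fun i _ => ?_
    split_ifs
    · exact hw i
    · rfl
  omega

/-! ### Scalar products of `omega` with the characters. -/

theorem sum_omega_mul_chi_eq (lam mu : d.Partition) :
    ∑ g, (omega lam g : ℂ) * chi mu g = ∑ f : Fin d → Fin d, (schurMonomial lam f : ℂ) *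
      ∑ g : Equiv.Perm (Fin d) with ∀ i, (f (g i) : ℕ) = f i, chi mu g := by
  classical
  have h1 : ∀ g, (omega lam g : ℂ) =
      ∑ f : Fin d → Fin d, if ∀ i, (f (g i) : ℕ) = f i then (schurMonomial lam f : ℂ) else 0 := by
    intro g
    rw [omega, fixSum, map_sum, ← sum_filter, Int.cast_sum]
    refine sum_congr ?_ fun f _ => rfl
    ext f
    simp [Fin.ext_iff]
  simp_rw [h1, sum_mul]
  rw [sum_comm]
  refine sum_congr rfl fun f _ => ?_
  rw [mul_sum, sum_filter]
  refine sum_congr rfl fun g _ => ?_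
  split_ifs <;> simp

theorem sum_omega_mul_chi_eq_zero {lam mu : d.Partition} (h : ¬ Dominated lam mu) :
    ∑ g, (omega lam g : ℂ) * chi mu g = 0 := by
  rw [sum_omega_mul_chi_eq]
  refine sum_eq_zero fun f _ => ?_
  by_cases hf : schurMonomial lam f = 0
  · rw [hf, Int.cast_zero, zero_mul]
  · rw [sum_stab_chi_eq_zero (f := fun i => (f i : ℕ)), mul_zero]
    exact fun h' => h fun k => (sum_part_le_card_lt hf k).trans (h' k)

/-- A contributing colouring has content squeezed between $\lambda$ and $\lambda$, hence equal to
it. Such a colouring has coefficient one and contributes the order of its stabilizer; these orders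
add up to $d!$ over the orbit of the row function. -/
theorem sum_omega_mul_chi_self (lam : d.Partition) :
    ∑ g, (omega lam g : ℂ) * chi lam g = Fintype.card (Equiv.Perm (Fin d)) := by
  classical
  let f₀ : Fin d → Fin d := fun i => ⟨rowOf lam i, rowOf_lt lam i⟩
  have hf₀ : ∀ x, #{i | f₀ i = x} = part lam x := fun x => by
    rw [← card_rowOf_eq]
    simp [f₀, Fin.ext_iff]
  rw [sum_omega_mul_chi_eq, ← sum_card_stab f₀, Nat.cast_sum, sum_filter]
  refine sum_congr rfl fun f _ => ?_
  split_ifs with hf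
  · simp_rw [hf₀] at hf
    rw [schurMonomial_eq_one hf, Int.cast_one, one_mul,
      sum_stab_chi_eq_card (f := fun i => (f i : ℕ))]
    · simp [Fin.ext_iff]
    · intro r
      rcases lt_or_ge r d with hr | hr
      · rw [← hf ⟨r, hr⟩]
        simp [Fin.ext_iff]
      · rw [part_of_le lam hr, card_eq_zero, filter_eq_empty_iff]
        intro i _ hi
        have := (f i).2
        omega
  · by_cases h0 : schurMonomial lam f = 0
    · rw [h0, Int.cast_zero, zero_mul]
    · rw [sum_stab_chi_eq_zero (f := fun i => (f i : ℕ)), mul_zero]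
      intro h'
      have heq : ∀ k, #{j | (f j : ℕ) < k} = ∑ r ∈ range k, part lam r := fun k =>
        le_antisymm (h' k) (sum_part_le_card_lt h0 k)
      refine hf fun x => ?_
      have h1 := heq (x + 1)
      have h2 := heq x
      rw [card_lt_eq_sum (fun j => (f j : ℕ)), sum_range_succ] at h1
      rw [card_lt_eq_sum (fun j => (f j : ℕ))] at h2
      rw [sum_range_succ, ← h2] at h1
      rw [hf₀, ← Nat.add_left_cancel h1]
      simp [Fin.ext_iff]

end Frobenius

end TypeI

end

noncomputable section

namespace TypeI

open Finset MvPolynomial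

/-! ### Conjugacy classes and the character table -/

section CharTable

variable {d : ℕ}

/-- The cycle type of a permutation as a partition of `d`. -/
def cycleParts (g : Equiv.Perm (Fin d)) : d.Partition where
  parts := g.partition.parts
  parts_pos := g.partition.parts_pos
  parts_sum := by rw [g.partition.parts_sum, Fintype.card_fin]

theorem isConj_of_parts_eq {g h : Equiv.Perm (Fin d)} (e : g.partition.parts = h.partition.parts) :
    IsConj g h :=
  Equiv.Perm.partition_eq_of_isConj.2 (Nat.Partition.ext e)

theorem parts_eq_of_isConj {g h : Equiv.Perm (Fin d)} (e : IsConj g h) :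
    g.partition.parts = h.partition.parts :=
  congrArg Nat.Partition.parts (Equiv.Perm.partition_eq_of_isConj.1 e)

/-- The size of the class attached to `μ` divided by the order of the group. -/
def classWeight (mu : d.Partition) : ℂ :=
  (#{g : Equiv.Perm (Fin d) | cycleParts g = mu} : ℂ) / Fintype.card (Equiv.Perm (Fin d))

theorem sum_classFunction (s : d.Partition → Equiv.Perm (Fin d)) (hs : ∀ mu, HasType (s mu) mu)
    (F : Equiv.Perm (Fin d) → ℂ) (hF : ∀ g h, IsConj g h → F g = F h) :
    ∑ mu, classWeight mu * F (s mu) = (∑ g, F g) / Fintype.card (Equiv.Perm (Fin d)) := by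
  rw [← sum_fiberwise_of_maps_to (g := cycleParts) (t := univ) (fun _ _ => mem_univ _), sum_div]
  refine sum_congr rfl fun mu _ => ?_
  rw [classWeight, div_mul_eq_mul_div]
  congr 1
  rw [sum_congr rfl fun g hg => hF g (s mu) (isConj_of_parts_eq ?_), sum_const, nsmul_eq_mul]
  rw [hs mu, ← (mem_filter.1 hg).2]
  rfl

theorem fixSum_conj {R ι : Type*} [CommRing R] [Fintype ι] (g h : Equiv.Perm (Fin d)) (z : ι → R) :
    fixSum (h * g * h⁻¹) z = fixSum g z := by
  classical
  rw [fixSum, fixSum]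
  refine sum_nbij' (fun f i => f (h i)) (fun f i => f (h⁻¹ i)) ?_ ?_ ?_ ?_ ?_
  · intro f hf
    simp only [mem_filter, mem_univ, true_and] at hf ⊢
    intro i
    simpa using hf (h i)
  · intro f hf
    simp only [mem_filter, mem_univ, true_and] at hf ⊢
    intro i
    simpa using hf (h⁻¹ i)
  · intro f _; simp
  · intro f _; simp
  · intro f _
    exact (Equiv.prod_comp h fun j => z (f j)).symm

theorem omega_eq_of_isConj (lam : d.Partition) {g g' : Equiv.Perm (Fin d)} (h : IsConj g g') :
    omega lam g = omega lam g' := by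
  obtain ⟨k, rfl⟩ := isConj_iff.1 h
  rw [omega, omega, fixSum_conj]

theorem numCycles_eq_of_isConj {g g' : Equiv.Perm (Fin d)} (h : IsConj g g') :
    numCycles g = numCycles g' := by
  rw [numCycles, numCycles, parts_eq_of_isConj h]

theorem card_perm_ne_zero : (Fintype.card (Equiv.Perm (Fin d)) : ℂ) ≠ 0 :=
  Nat.cast_ne_zero.2 Fintype.card_ne_zero

/-- The matrix of the coefficients of the products of power sums. -/
def omegaTable (s : d.Partition → Equiv.Perm (Fin d)) : Matrix d.Partition d.Partition ℂ :=
  Matrix.of fun lam mu => (omega lam (s mu) : ℂ)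

theorem mul_diagonal_mul_transpose_apply (X Y : Matrix d.Partition d.Partition ℂ)
    (w : d.Partition → ℂ) (lam mu : d.Partition) :
    (X * Matrix.diagonal w * Y.transpose) lam mu = ∑ nu, w nu * (X lam nu * Y mu nu) := by
  rw [Matrix.mul_apply]
  refine sum_congr rfl fun nu _ => ?_
  rw [Matrix.mul_diagonal, Matrix.transpose_apply]
  ring

theorem charTable_orthogonal (s : d.Partition → Equiv.Perm (Fin d))
    (hs : ∀ mu, HasType (s mu) mu) :
    charTable s * Matrix.diagonal classWeight * (charTable s).transpose = 1 := by
  ext lam mu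
  rw [mul_diagonal_mul_transpose_apply]
  simp only [charTable, Matrix.of_apply]
  rw [sum_classFunction s hs (fun g => chi lam g * chi mu g) fun g h hgh => by
    rw [chi_eq_of_isConj lam hgh, chi_eq_of_isConj mu hgh], sum_chi_mul_chi, Matrix.one_apply]
  split_ifs
  · exact div_self card_perm_ne_zero
  · exact zero_div _

theorem omegaTable_orthogonal (s : d.Partition → Equiv.Perm (Fin d))
    (hs : ∀ mu, HasType (s mu) mu) :
    omegaTable s * Matrix.diagonal classWeight * (omegaTable s).transpose = 1 := by
  ext lam mu
  rw [mul_diagonal_mul_transpose_apply]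
  simp only [omegaTable, Matrix.of_apply]
  rw [sum_classFunction s hs (fun g => (omega lam g : ℂ) * omega mu g) fun g h hgh => by
    rw [omega_eq_of_isConj lam hgh, omega_eq_of_isConj mu hgh], Matrix.one_apply]
  have h := congrArg (Int.cast : ℤ → ℂ) (sum_omega_mul_omega lam mu)
  push_cast at h
  rw [h]
  split_ifs
  · exact div_self card_perm_ne_zero
  · exact zero_div _

theorem diagonal_mul_transpose_mul_charTable (s : d.Partition → Equiv.Perm (Fin d))
    (hs : ∀ mu, HasType (s mu) mu) :
    Matrix.diagonal classWeight * (charTable s).transpose * charTable s = 1 := by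
  rw [mul_eq_one_comm, ← mul_assoc]
  exact charTable_orthogonal s hs

/-- With $\Omega$ the table of `omega`, the matrix $V=\Omega W\mathsf X^T$ of scalar products
satisfies $VV^T=\Omega(W\mathsf X^T\mathsf X)W\Omega^T=\Omega W\Omega^T=1$, so the unitriangularity
criterion applies. -/
theorem omegaTable_mul_charTable (s : d.Partition → Equiv.Perm (Fin d))
    (hs : ∀ mu, HasType (s mu) mu) :
    omegaTable s * Matrix.diagonal classWeight * (charTable s).transpose = 1 := by
  have hV : ∀ lam mu : d.Partition, (omegaTable s * Matrix.diagonal classWeight *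
      (charTable s).transpose : Matrix d.Partition d.Partition ℂ) lam mu =
      (∑ g, (omega lam g : ℂ) * chi mu g) / Fintype.card (Equiv.Perm (Fin d)) := by
    intro lam mu
    rw [mul_diagonal_mul_transpose_apply]
    exact sum_classFunction s hs (fun g => (omega lam g : ℂ) * chi mu g) fun g h hgh => by
      rw [omega_eq_of_isConj lam hgh, chi_eq_of_isConj mu hgh]
  refine eq_one_of_unitriangular (fun lam mu h => ?_) (fun lam => ?_) ?_
  · rw [hV, sum_omega_mul_chi_eq_zero h, zero_div]
  · rw [hV, sum_omega_mul_chi_self, div_self card_perm_ne_zero]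
  · rw [Matrix.transpose_mul, Matrix.transpose_mul, Matrix.transpose_transpose,
      Matrix.diagonal_transpose]
    calc omegaTable s * Matrix.diagonal classWeight * (charTable s).transpose *
          (charTable s * (Matrix.diagonal classWeight * (omegaTable s).transpose))
        = omegaTable s * (Matrix.diagonal classWeight * (charTable s).transpose * charTable s) *
          (Matrix.diagonal classWeight * (omegaTable s).transpose) := by
          simp only [mul_assoc]
      _ = 1 := by
          rw [diagonal_mul_transpose_mul_charTable s hs, mul_one, ← mul_assoc,
            omegaTable_orthogonal s hs]

/-- The Frobenius character formula. -/
theorem omegaTable_eq_charTable (s : d.Partition → Equiv.Perm (Fin d))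
    (hs : ∀ mu, HasType (s mu) mu) : omegaTable s = charTable s := by
  calc omegaTable s = omegaTable s *
        (Matrix.diagonal classWeight * (charTable s).transpose * charTable s) := by
        rw [diagonal_mul_transpose_mul_charTable s hs, mul_one]
    _ = omegaTable s * Matrix.diagonal classWeight * (charTable s).transpose * charTable s := by
        simp only [mul_assoc]
    _ = charTable s := by rw [omegaTable_mul_charTable s hs, one_mul]

theorem charTable_inv (s : d.Partition → Equiv.Perm (Fin d))
    (hs : ∀ mu, HasType (s mu) mu) :
    (charTable s)⁻¹ = Matrix.diagonal classWeight * (charTable s).transpose :=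
  Matrix.inv_eq_left_inv (diagonal_mul_transpose_mul_charTable s hs)

theorem isUnit_det_charTable (s : d.Partition → Equiv.Perm (Fin d))
    (hs : ∀ mu, HasType (s mu) mu) : IsUnit (charTable s).det :=
  (Matrix.isUnit_iff_isUnit_det _).1
    (IsUnit.of_mul_eq_one_right _ (diagonal_mul_transpose_mul_charTable s hs))

theorem A_eq_conj (s : d.Partition → Equiv.Perm (Fin d))
    (hs : ∀ mu, HasType (s mu) mu) {n : ℕ} (hn : 1 ≤ n) : (A n d).map (Int.cast : ℤ → ℂ) =
    charTable s * Matrix.diagonal (fun mu => (n : ℂ) ^ numCycles (s mu)) * (charTable s)⁻¹ := by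
  rw [charTable_inv s hs, ← omegaTable_eq_charTable s hs]
  ext lam mu
  rw [← mul_assoc, mul_assoc (omegaTable s), Matrix.diagonal_mul_diagonal,
    mul_diagonal_mul_transpose_apply]
  simp only [omegaTable, Matrix.of_apply, Matrix.map_apply]
  have h1 := sum_classFunction s hs
    (fun g => (n : ℂ) ^ numCycles g * ((omega lam g : ℂ) * omega mu g)) fun g h hgh => by
      rw [omega_eq_of_isConj lam hgh, omega_eq_of_isConj mu hgh, numCycles_eq_of_isConj hgh]
  have h2 := congrArg (Int.cast : ℤ → ℂ) (card_mul_A hn lam mu)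
  push_cast at h2
  rw [← h2, mul_div_cancel_left₀ _ card_perm_ne_zero] at h1
  rw [← h1]
  exact sum_congr rfl fun nu _ => by ring

theorem spectrum_A (s : d.Partition → Equiv.Perm (Fin d))
    (hs : ∀ mu, HasType (s mu) mu) {n : ℕ} (hn : 1 ≤ n) :
    spectrum ℂ ((A n d).map (Int.cast : ℤ → ℂ)) =
    Set.range (fun g : Equiv.Perm (Fin d) => (n : ℂ) ^ numCycles g) := by
  obtain ⟨u, hu⟩ := (Matrix.isUnit_iff_isUnit_det _).2 (isUnit_det_charTable s hs)
  rw [A_eq_conj s hs hn, ← hu, ← Matrix.coe_units_inv, spectrum.units_conjugate, spectrum_diagonal]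
  ext x
  constructor
  · rintro ⟨mu, rfl⟩
    exact ⟨s mu, rfl⟩
  · rintro ⟨g, rfl⟩
    -- The representative of the class of `g` has as many cycles as `g`.
    refine ⟨cycleParts g, ?_⟩
    simp only
    rw [numCycles_eq_of_isConj (isConj_of_parts_eq (hs (cycleParts g)))]

end CharTable

end TypeI

end

theorem mainTheorem3 (n d : ℕ) (hn : 1 ≤ n)
    (s : d.Partition → Equiv.Perm (Fin d)) (hs : ∀ mu, TypeI.HasType (s mu) mu) :
    IsUnit (TypeI.charTable s).det ∧
      (TypeI.A n d).map (Int.cast : ℤ → ℂ) =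
        TypeI.charTable s *
          Matrix.diagonal (fun mu => (n : ℂ) ^ TypeI.numCycles (s mu)) *
          (TypeI.charTable s)⁻¹ ∧
      spectrum ℂ ((TypeI.A n d).map (Int.cast : ℤ → ℂ)) =
        Set.range (fun g : Equiv.Perm (Fin d) => (n : ℂ) ^ TypeI.numCycles g) :=
  ⟨TypeI.isUnit_det_charTable s hs, TypeI.A_eq_conj s hs hn, TypeI.spectrum_A s hs hn⟩
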